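/- Let $G=(V,E)$ be a finite undirected multigraph with $n$ vertices and $m$ edges, and let $\deg(u)$ be the number of half-edges at $u$ (so edges count with multiplicity, and a loop counts twice). In each step a random walk traverses a half-edge chosen uniformly at random among those at its current vertex. Let $\beta,\varepsilon\in(0,1)$, let $L,\rho$ be natural numbers, and let $p_e\in[\beta,1]$ for $e\in E$. A collection $W$ of $\beta$-shorted walks is generated as follows. Each edge $e$ is selected independently with probability $p_e$; the set $T$ of terminals consists of all endpoints of selected edges. Then, for each edge and each of its two endpoints $u$, $\rho$ independent random walks are started at $u$, each of which is run until it reaches $T$ or has taken $L$ steps. The load $N_e$ of an edge $e$ is the number of walks in $W$ that traverse $e$. **Theorem.** For all constants $c_0,c,a,C_\rho>0$ there is a constant $K_0>0$ such that for every $K_1$ there is a constant $C>0$ with the following property. Let $G,\beta,\varepsilon,(p_e),L,\rho$ be as above with $$\beta m\ \ge\ c_0\log n,\qquad K_0\,\beta^{-2}\log^3 n\ \le\ L\ \le\ K_1\,\beta^{-2}\log^3 n,\qquad \rho\ \le\ C_\rho\,\varepsilon^{-2}\log n .$$ 1. For each walk in $W$, the probability that it starts in a connected component that contains a vertex of $T$,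 but does not end at a vertex of $T$, is at most $n^{-c}$. If moreover $\varepsilon\ge n^{-a}$, then with probability at least $1-n^{-c}$ all walks in $W$ that start in a connected component containing a vertex of $T$ simultaneously end at a vertex of $T$. 2. For every edge $e$, $\ \mathbb E[N_e]\le C\,\beta^{-2}\varepsilon^{-2}\log^4 n$. 3. For every vertex $\hat u$ and every $t\ge 0$, $\ \sum_{u\in V}\deg(u)\cdot\Pr[X_u(t)=\hat u]=\deg(\hat u)$, where $X_u(t)$ is the position after $t$ steps of a (never stopped) random walk from $u$ (a walk at an isolated vertex stays there). -/

import Mathlib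

open scoped Graph

noncomputable section

namespace Graph

open MeasureTheory

variable {α β : Type*}

/-- One of the two ends of an edge (in an arbitrary fixed order); for a loop both ends agree. -/
def leftEnd (G : Graph α β) (e : E(G)) : α :=
  (exists_isLink_of_mem_edgeSet e.2).choose

/-- The other end of an edge. -/
def rightEnd (G : Graph α β) (e : E(G)) : α :=
  (exists_isLink_of_mem_edgeSet e.2).choose_spec.choose

theorem isLink_leftEnd_rightEnd (G : Graph α β) (e : E(G)) :
    G.IsLink e.1 (G.leftEnd e) (G.rightEnd e) :=
  (exists_isLink_of_mem_edgeSet e.2).choose_spec.choose_spec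

/-- A half-edge: an edge with a direction of traversal. Every edge carries exactly two of them
(also a loop, which therefore contributes two to the degree). -/
abbrev HalfEdge (G : Graph α β) : Type _ := E(G) × Bool

/-- The vertex at which a half-edge starts. -/
def tail (G : Graph α β) (d : G.HalfEdge) : α :=
  if d.2 then G.rightEnd d.1 else G.leftEnd d.1

/-- The vertex at which a half-edge arrives. -/
def head (G : Graph α β) (d : G.HalfEdge) : α :=
  if d.2 then G.leftEnd d.1 else G.rightEnd d.1

theorem isLink_tail_head (G : Graph α β) (d : G.HalfEdge) :
    G.IsLink d.1.1 (G.tail d) (G.head d) := by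
  unfold tail head
  split
  · exact (G.isLink_leftEnd_rightEnd d.1).symm
  · exact G.isLink_leftEnd_rightEnd d.1

open Classical in
/-- The half-edges that leave `x`. -/
def outHalfEdges (G : Graph α β) [Fintype E(G)] (x : α) : Finset G.HalfEdge :=
  Finset.univ.filter fun d => G.tail d = x

/-- The degree of `x`, edges counted with multiplicity. -/
def deg (G : Graph α β) [Fintype E(G)] (x : α) : ℕ := (G.outHalfEdges x).card

/-- Being in the same connected component. -/
def SameComponent (G : Graph α β) (x y : α) : Prop := Relation.ReflTransGen G.Adj x y

/-- Sequences of half-edges carry the discrete σ-algebra. -/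
instance instMeasurableSpaceListHalfEdge (G : Graph α β) : MeasurableSpace (List G.HalfEdge) := ⊤

instance instDiscreteMeasurableSpaceListHalfEdge (G : Graph α β) :
    DiscreteMeasurableSpace (List G.HalfEdge) := ⟨fun _ => trivial⟩

/-- The law of the (simple) random walk with `k` steps from `x`, recorded as the list of the
half-edges it traverses: in each step one of the half-edges that leave the current vertex is chosen
uniformly at random. At an isolated vertex the walk stays where it is. -/
def walkLaw (G : Graph α β) [Fintype E(G)] : ℕ → α → PMF (List G.HalfEdge)
  | 0, _ => PMF.pure []
  | k + 1, x =>
    open Classical in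
    if h : (G.outHalfEdges x).Nonempty then
      (PMF.uniformOfFinset (G.outHalfEdges x) h).bind fun d =>
        (walkLaw G k (G.head d)).map fun w => d :: w
    else PMF.pure []

/-- The final vertex of the walk that starts at `x` and traverses `w`. -/
def endVertex (G : Graph α β) : α → List G.HalfEdge → α
  | x, [] => x
  | _, d :: w => endVertex G (G.head d) w

open Classical in
/-- The walk `w` from `x`, stopped at the first vertex that lies in `T`. -/
def stopAt (G : Graph α β) (T : Set α) : α → List G.HalfEdge → List G.HalfEdge
  | _, [] => []
  | x, d :: w => if x ∈ T then [] else d :: stopAt G T (G.head d) w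

/-- The terminals: all ends of the selected edges. -/
def terminals (G : Graph α β) (S : E(G) → Bool) : Set α :=
  {x | ∃ e : E(G), S e = true ∧ G.Inc e.1 x}

/-- The outcomes of the experiment that generates a collection of shorted walks with `r` walks per
end of each edge. The first component tells which edges are selected. The second component holds
for each half-edge `d` and each `i < r` a walk from the tail of `d`, not yet stopped; as `d` runs
over the two half-edges of an edge, its tail runs over the two ends of that edge. -/
abbrev ShortedOutcome (G : Graph α β) (r : ℕ) : Type _ :=
  (E(G) → Bool) × (G.HalfEdge × Fin r → List G.HalfEdge)

/-- The law of the experiment: edge `e` is selected with probability `p e`, the walks are random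
walks with `L` steps, and all these choices are independent. -/
def shortedLaw (G : Graph α β) [Fintype E(G)] (p : E(G) → unitInterval) (L r : ℕ) :
    Measure (G.ShortedOutcome r) :=
  (Measure.pi fun e => ProbabilityTheory.bernoulliMeasure true false (p e)).prod
    (Measure.pi fun j : G.HalfEdge × Fin r => (G.walkLaw L (G.tail j.1)).toMeasure)

/-- The walk with index `j` in the collection: it runs until it reaches a terminal or has taken
all its steps. -/
def shortedWalk (G : Graph α β) {r : ℕ} (ω : G.ShortedOutcome r) (j : G.HalfEdge × Fin r) :
    List G.HalfEdge :=
  G.stopAt (G.terminals ω.1) (G.tail j.1) (ω.2 j)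

/-- Walk `j` starts in a component that contains a terminal, but does not end at a terminal. -/
def Misses (G : Graph α β) {r : ℕ} (ω : G.ShortedOutcome r) (j : G.HalfEdge × Fin r) : Prop :=
  (∃ t ∈ G.terminals ω.1, G.SameComponent (G.tail j.1) t) ∧
    G.endVertex (G.tail j.1) (G.shortedWalk ω j) ∉ G.terminals ω.1

open Classical in
/-- The load of the edge `e`: the number of walks in the collection that pass through `e`. -/
def load (G : Graph α β) [Fintype E(G)] {r : ℕ} (ω : G.ShortedOutcome r) (e : E(G)) : ℕ :=
  (Finset.univ.filter fun j : G.HalfEdge × Fin r => ∃ d ∈ G.shortedWalk ω j, d.1 = e).card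

end Graph

end

/-!
The two quantitative statements rest on one estimate: a random walk discovers `N` distinct
half-edges, or reaches the terminals, within `O(N ^ 2)` steps on average.

To see this, let `T` be the set of terminals and suppose that some terminal is reachable from the
start. The number of steps taken is the sum, over the half-edges `d` discovered so far, of the
number of traversals of `d`. Before `N` half-edges are discovered, the walk stays within distance
`N - 1` of the tail of every half-edge that it has discovered. So the traversals of `d` are counted
by the Green function `green` of the walk killed outside the ball of radius `N - 1` around the tail
of `d`, and on `T`. This Green function is the voltage of a current of strength at most one;
it drops by at most one along each half-edge (`green_tail_sub_green_head_le`), and since it vanishes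
somewhere within distance `N` of the tail of `d`, it is at most `N` (`green_le_of_mem_ball`).
Hence at most `N * (N + 1)` steps are needed on average (`mul_walkProb_confined_le`). By the Markov
property, `k` blocks of `6 * N ^ 2` steps fail with probability at most `exp (-k)`
(`walkProb_confined_le_pow`). Let `ℓ` be the logarithm of the number `n` of vertices. With `N` of
order `ℓ / β`, `N` half-edges discovered by a walk, which is independent of the selection, all lie
on unselected edges with probability at most `exp (-β * N / 2)`, which is polynomially small; and
`k` of order `ℓ` yields the length `ℓ ^ 3 / β ^ 2` (`shortedLaw_misses_le_exp`).

The number of edges is not bounded in terms of `n`, so for the simultaneous statement a union bound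
over all walks is too expensive. But vertices of degree above a constant times `ℓ / β` are all
terminals with high probability, and a walk from a terminal does not miss. There remain about
`n * ℓ / β` starting half-edges. If `1 / β` is polynomial in `n`, the union bound suffices;
otherwise the few half-edges outside of `T` make the hitting time of `T`, which is at most about
`n ^ 2 * ℓ / β`, much smaller than the length of the walks (`shortedLaw_misses_and_deg_le`).

The load and the last statement follow from stationarity of the degree distribution
(`sum_average_out`, `lintegral_load_le`, `sum_deg_mul_walkLaw_endVertex`).
-/

noncomputable section
namespace Graph
open MeasureTheory

variable {α β : Type*}

section RandomWalk

/-! ### Half-edges -/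

/-- The same edge, traversed in the opposite direction. -/
def reverse (G : Graph α β) : G.HalfEdge ≃ G.HalfEdge :=
  (Equiv.refl _).prodCongr Equiv.boolNot

@[simp] theorem tail_reverse (G : Graph α β) (d : G.HalfEdge) :
    G.tail (G.reverse d) = G.head d := by
  rcases d with ⟨e, _ | _⟩ <;> simp [reverse, tail, head]

@[simp] theorem head_reverse (G : Graph α β) (d : G.HalfEdge) :
    G.head (G.reverse d) = G.tail d := by
  rcases d with ⟨e, _ | _⟩ <;> simp [reverse, tail, head]

theorem exists_halfEdge_of_adj {G : Graph α β} {x y : α} (h : G.Adj x y) :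
    ∃ d : G.HalfEdge, G.tail d = x ∧ G.head d = y := by
  obtain ⟨e, he⟩ := h
  have h1 := G.isLink_tail_head (⟨e, he.edge_mem⟩, false)
  rcases he.eq_and_eq_or_eq_and_eq h1 with ⟨h, h'⟩ | ⟨h, h'⟩
  · exact ⟨_, h.symm, h'.symm⟩
  · exact ⟨G.reverse (⟨e, he.edge_mem⟩, false), by simp [h], by simp [h']⟩

theorem adj_tail_head (G : Graph α β) (d : G.HalfEdge) : G.Adj (G.tail d) (G.head d) :=
  ⟨_, G.isLink_tail_head d⟩

theorem tail_mem (G : Graph α β) (d : G.HalfEdge) : G.tail d ∈ V(G) :=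
  (G.isLink_tail_head d).left_mem

variable (G : Graph α β) [Fintype E(G)]

@[simp] theorem mem_outHalfEdges {x : α} {d : G.HalfEdge} :
    d ∈ G.outHalfEdges x ↔ G.tail d = x := by
  simp [outHalfEdges]

theorem deg_tail_pos (d : G.HalfEdge) : 0 < G.deg (G.tail d) :=
  Finset.card_pos.2 ⟨d, by simp⟩

/-! ### Expectations along the random walk -/

open Classical in
/-- The expectation of `f` under the law of the random walk with `k` steps from `x`. -/
def walkExp : ℕ → α → (List G.HalfEdge → ℝ) → ℝ
  | 0, _, f => f []
  | k + 1, x, f =>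
    if (G.outHalfEdges x).Nonempty then
      (∑ d ∈ G.outHalfEdges x, walkExp k (G.head d) fun w => f (d :: w)) / G.deg x
    else f []

/-- The half-edges of `w` can be traversed one after the other from `x`. Only such lists have
positive probability, while `endVertex` and `stopAt` are defined for all lists. -/
def IsWalkFrom (G : Graph α β) : α → List G.HalfEdge → Prop
  | _, [] => True
  | x, d :: w => G.tail d = x ∧ IsWalkFrom G (G.head d) w

variable {G}

theorem walkExp_mono (k : ℕ) (x : α) {f g : List G.HalfEdge → ℝ}
    (h : ∀ w, G.IsWalkFrom x w → f w ≤ g w) : G.walkExp k x f ≤ G.walkExp k x g := by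
  induction k generalizing x f g with
  | zero => exact h [] trivial
  | succ k ih =>
    simp only [walkExp]
    split_ifs
    · gcongr with d hd
      exact ih _ fun w hw => h _ ⟨by simpa using hd, hw⟩
    · exact h [] trivial

theorem walkExp_mul_right (k : ℕ) (x : α) (f : List G.HalfEdge → ℝ) (c : ℝ) :
    G.walkExp k x (fun w => f w * c) = G.walkExp k x f * c := by
  induction k generalizing x f with
  | zero => rfl
  | succ k ih =>
    simp only [walkExp, ih, ← Finset.sum_mul]
    split_ifs <;> ring

theorem walkExp_const (k : ℕ) (x : α) (c : ℝ) : G.walkExp k x (fun _ => c) = c := by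
  induction k generalizing x with
  | zero => rfl
  | succ k ih =>
    simp only [walkExp, ih]
    split_ifs with h
    · have : (G.deg x : ℝ) ≠ 0 := by
        have := Finset.card_pos.2 h
        exact_mod_cast this.ne'
      rw [Finset.sum_const, nsmul_eq_mul]
      exact mul_div_cancel_left₀ _ this
    · rfl

theorem walkExp_add (k : ℕ) (x : α) (f g : List G.HalfEdge → ℝ) :
    G.walkExp k x (fun w => f w + g w) = G.walkExp k x f + G.walkExp k x g := by
  induction k generalizing x f g with
  | zero => rfl
  | succ k ih =>
    simp only [walkExp, ih, Finset.sum_add_distrib]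
    split_ifs <;> ring

theorem walkExp_nonneg (k : ℕ) (x : α) {f : List G.HalfEdge → ℝ} (h : ∀ w, 0 ≤ f w) :
    0 ≤ G.walkExp k x f :=
  (walkExp_const k x 0).symm.le.trans (walkExp_mono k x fun w _ => h w)

theorem walkExp_le (k : ℕ) (x : α) {f : List G.HalfEdge → ℝ} {c : ℝ} (h : ∀ w, f w ≤ c) :
    G.walkExp k x f ≤ c :=
  (walkExp_mono k x fun w _ => h w).trans (walkExp_const k x c).le

/-- At a vertex without half-edges the walk does not move. -/
theorem walkExp_of_isolated {x : α} (h : ¬ (G.outHalfEdges x).Nonempty) (k : ℕ)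
    (f : List G.HalfEdge → ℝ) : G.walkExp k x f = f [] := by
  cases k <;> simp [walkExp, h]

/-- The Markov property at a fixed time. -/
theorem walkExp_steps_add (s k : ℕ) (x : α) (f : List G.HalfEdge → ℝ) :
    G.walkExp (s + k) x f =
      G.walkExp s x fun w => G.walkExp k (G.endVertex x w) fun w' => f (w ++ w') := by
  induction s generalizing x f with
  | zero => simp [walkExp, endVertex]
  | succ s ih =>
    rw [Nat.add_right_comm]
    by_cases h : (G.outHalfEdges x).Nonempty
    · simp [walkExp, h, ih, endVertex]
    · rw [walkExp_of_isolated h, walkExp_of_isolated h]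
      simp [endVertex, walkExp_of_isolated h]

theorem walkLaw_toMeasure_apply (k : ℕ) (x : α) (A : Set (List G.HalfEdge)) :
    (G.walkLaw k x).toMeasure A = ENNReal.ofReal (G.walkExp k x (A.indicator 1)) := by
  classical
  have base : ∀ A : Set (List G.HalfEdge), (PMF.pure ([] : List G.HalfEdge)).toMeasure A =
      ENNReal.ofReal (A.indicator 1 []) := by
    intro A
    rw [PMF.toMeasure_pure_apply _ _ (.of_discrete), Set.indicator_apply]
    split_ifs <;> simp
  induction k generalizing x A with
  | zero => exact base A
  | succ k ih =>
    by_cases h : (G.outHalfEdges x).Nonempty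
    · simp only [walkLaw, walkExp, h, dif_pos, if_true]
      rw [PMF.toMeasure_bind_apply _ _ _ (.of_discrete), tsum_fintype]
      have hdeg : (0 : ℝ) < G.deg x := by exact_mod_cast Finset.card_pos.2 h
      have hnn : ∀ d : G.HalfEdge, 0 ≤ G.walkExp k (G.head d) fun w => A.indicator 1 (d :: w) :=
        fun d => walkExp_nonneg _ _ fun w => Set.indicator_nonneg (fun _ _ => zero_le_one) _
      rw [div_eq_inv_mul, ENNReal.ofReal_mul (by positivity),
        ENNReal.ofReal_sum_of_nonneg fun d _ => hnn d, Finset.mul_sum,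
        ← Finset.sum_subset (Finset.subset_univ (G.outHalfEdges x))]
      · refine Finset.sum_congr rfl fun d hd => ?_
        rw [PMF.uniformOfFinset_apply_of_mem _ hd,
          PMF.toMeasure_map_apply _ _ _ (.of_discrete) (.of_discrete), ih,
          ENNReal.ofReal_inv_of_pos hdeg, ENNReal.ofReal_natCast]
        rfl
      · intro d _ hd
        rw [PMF.uniformOfFinset_apply_of_notMem _ hd, zero_mul]
    · simp only [walkLaw, walkExp, h, dif_neg, if_false, not_false_eq_true]
      exact base A

/-! ### Stationarity -/

/-- A uniformly random half-edge, followed by a uniformly random half-edge at its tail, is again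
a uniformly random half-edge. -/
theorem sum_average_out (F : G.HalfEdge → ℝ) :
    ∑ d₀ : G.HalfEdge, (∑ d ∈ G.outHalfEdges (G.tail d₀), F d) / G.deg (G.tail d₀) =
      ∑ d, F d := by
  classical
  simp only [outHalfEdges, Finset.sum_filter, Finset.sum_div]
  rw [Finset.sum_comm]
  refine Finset.sum_congr rfl fun d _ => ?_
  have : ∀ d₀ : G.HalfEdge, (if G.tail d = G.tail d₀ then F d else 0) / (G.deg (G.tail d₀) : ℝ) =
      if G.tail d₀ = G.tail d then F d / G.deg (G.tail d) else 0 := by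
    intro d₀
    by_cases h : G.tail d = G.tail d₀
    · simp [h]
    · rw [if_neg h, if_neg (Ne.symm h), zero_div]
  simp only [this, ← Finset.sum_filter]
  rw [Finset.sum_const, nsmul_eq_mul]
  have h0 : (G.deg (G.tail d) : ℝ) ≠ 0 := by exact_mod_cast (G.deg_tail_pos d).ne'
  refine (congrArg₂ (· * ·) ?_ rfl).trans (mul_div_cancel₀ _ h0)
  simp only [deg, outHalfEdges]

theorem sum_head (F : α → ℝ) : ∑ d : G.HalfEdge, F (G.head d) = ∑ d : G.HalfEdge, F (G.tail d) := by
  rw [← Equiv.sum_comp G.reverse]; simp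

theorem sum_walkExp_succ (k : ℕ) (f : α → List G.HalfEdge → ℝ) :
    ∑ d₀ : G.HalfEdge, G.walkExp (k + 1) (G.tail d₀) (f (G.tail d₀)) =
      ∑ d : G.HalfEdge, G.walkExp k (G.head d) fun w => f (G.tail d) (d :: w) := by
  refine Eq.trans ?_ (sum_average_out _)
  refine Finset.sum_congr rfl fun d₀ _ => ?_
  have h : (G.outHalfEdges (G.tail d₀)).Nonempty := ⟨d₀, by simp⟩
  rw [walkExp, if_pos h]
  refine congrArg (· / (G.deg (G.tail d₀) : ℝ)) (Finset.sum_congr rfl fun d hd => ?_)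
  rw [(G.mem_outHalfEdges.1 hd)]

/-- The degree distribution is stationary. -/
theorem sum_walkExp_endVertex (F : α → ℝ) (k : ℕ) :
    ∑ d : G.HalfEdge, G.walkExp k (G.tail d) (fun w => F (G.endVertex (G.tail d) w)) =
      ∑ d : G.HalfEdge, F (G.tail d) := by
  induction k with
  | zero => rfl
  | succ k ih =>
    rw [sum_walkExp_succ k fun x w => F (G.endVertex x w), ← ih]
    simp only [endVertex]
    exact sum_head fun x => G.walkExp k x fun w => F (G.endVertex x w)

open Classical in
/-- Walks from the tails of all half-edges traverse a given edge twice per step on average. -/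
theorem sum_walkExp_countP (e : E(G)) (k : ℕ) :
    ∑ d : G.HalfEdge, G.walkExp k (G.tail d) (fun w => (w.countP fun d => d.1 = e : ℕ)) =
      2 * (k : ℝ) := by
  induction k with
  | zero => simp [walkExp]
  | succ k ih =>
    rw [sum_walkExp_succ k fun _ w => ((w.countP fun d => d.1 = e : ℕ) : ℝ)]
    simp only [List.countP_cons, Nat.cast_add, walkExp_add, Finset.sum_add_distrib, walkExp_const]
    rw [sum_head fun x => G.walkExp k x fun w => ((w.countP fun d => d.1 = e : ℕ) : ℝ), ih]
    have : ∑ d : G.HalfEdge, (((if decide (d.1 = e) = true then 1 else 0 : ℕ)) : ℝ) = 2 := by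
      rw [Fintype.sum_prod_type]
      simp
    rw [this]; push_cast; ring

theorem sum_deg_mul [Fintype V(G)] (F : α → ℝ) :
    ∑ u : V(G), (G.deg u : ℝ) * F u = ∑ d : G.HalfEdge, F (G.tail d) := by
  classical
  rw [← Finset.sum_fiberwise (s := Finset.univ)
    (g := fun d : G.HalfEdge => (⟨G.tail d, G.tail_mem d⟩ : V(G)))]
  refine Finset.sum_congr rfl fun u _ => ?_
  rw [Finset.sum_congr rfl (g := fun _ => F u), Finset.sum_const, nsmul_eq_mul]
  · congr 2
    simp only [deg, outHalfEdges, Subtype.ext_iff]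
  · intro d hd
    simp only [Finset.mem_filter, Finset.mem_univ, true_and] at hd
    rw [← hd]

theorem sum_deg_mul_walkLaw_endVertex [Fintype V(G)] (t : ℕ) (v : α) :
    ∑ u : V(G), (G.deg u : ENNReal) * (G.walkLaw t u).toMeasure {w | G.endVertex u w = v} =
      (G.deg v : ENNReal) := by
  classical
  have key : ∑ u : V(G), (G.deg u : ℝ) *
      G.walkExp t u ({w | G.endVertex u w = v}.indicator 1) = G.deg v := by
    rw [sum_deg_mul fun u => G.walkExp t u ({w | G.endVertex u w = v}.indicator 1)]
    refine (sum_walkExp_endVertex (fun x => if x = v then 1 else 0) t).trans ?_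
    rw [← Finset.sum_filter, Finset.sum_const, nsmul_eq_mul, mul_one]
    simp only [deg, outHalfEdges]
  rw [← ENNReal.ofReal_natCast (G.deg v), ← key, ENNReal.ofReal_sum_of_nonneg]
  · refine Finset.sum_congr rfl fun u _ => ?_
    rw [walkLaw_toMeasure_apply, ENNReal.ofReal_mul (by positivity), ENNReal.ofReal_natCast]
  · exact fun u _ => mul_nonneg (by positivity)
      (walkExp_nonneg _ _ fun w => Set.indicator_nonneg (fun _ _ => zero_le_one) _)

end RandomWalk

section GreenFunction

/-! ### Balls -/

/-- The vertices that can be reached from a vertex in at most `k` steps. -/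
def ball (G : Graph α β) : ℕ → α → Set α
  | 0, x => {x}
  | k + 1, x => {y | y = x ∨ ∃ d, G.tail d = x ∧ y ∈ ball G k (G.head d)}

/-- A step from a vertex of `U` along some half-edge. -/
def StepFrom (G : Graph α β) (U : Set α) (x y : α) : Prop :=
  x ∈ U ∧ ∃ d, G.tail d = x ∧ G.head d = y

section Ball

variable {G : Graph α β}

theorem self_mem_ball (k : ℕ) (x : α) : x ∈ G.ball k x := by
  cases k
  · exact rfl
  · exact Or.inl rfl

theorem ball_mono {j k : ℕ} (h : j ≤ k) (x : α) : G.ball j x ⊆ G.ball k x := by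
  induction k generalizing j x with
  | zero => rw [Nat.le_zero.1 h]
  | succ k ih =>
    cases j with
    | zero => rintro y rfl; exact self_mem_ball _ _
    | succ j =>
      rintro y (rfl | ⟨d, rfl, hy⟩)
      · exact self_mem_ball _ _
      · exact Or.inr ⟨d, rfl, ih (by omega) _ hy⟩

theorem head_mem_ball {k : ℕ} {x : α} {d : G.HalfEdge} (h : G.tail d ∈ G.ball k x) :
    G.head d ∈ G.ball (k + 1) x := by
  induction k generalizing x with
  | zero => exact Or.inr ⟨d, h, rfl⟩
  | succ k ih =>
    rcases h with h | ⟨d', h', h⟩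
    · exact Or.inr ⟨d, h, self_mem_ball _ _⟩
    · exact Or.inr ⟨d', h', ih h⟩

/-- A path is cut at its last departure from `x`; what follows no longer uses `x`. -/
theorem mem_ball_of_reflTransGen (U : Finset α) {x y : α}
    (h : Relation.ReflTransGen (G.StepFrom U) x y) : y ∈ G.ball U.card x := by
  classical
  induction hn : U.card generalizing U x with
  | zero =>
    rcases h.cases_head with rfl | ⟨z, hz, _⟩
    · exact self_mem_ball _ _
    · rw [Finset.card_eq_zero.1 hn] at hz
      simpa using hz.1
  | succ n ih =>
    have key : y = x ∨ x ∈ U ∧ ∃ d, G.tail d = x ∧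
        Relation.ReflTransGen (G.StepFrom (U.erase x : Finset α)) (G.head d) y := by
      clear ih
      induction h with
      | refl => exact Or.inl rfl
      | tail _ hbc ih =>
        obtain ⟨hb, d, rfl, rfl⟩ := hbc
        by_cases hx : G.tail d = x
        · exact Or.inr ⟨hx ▸ hb, d, hx, .refl⟩
        · rcases ih with ih | ⟨h1, d', h2, h3⟩
          · exact absurd ih hx
          · exact Or.inr ⟨h1, d', h2, h3.tail ⟨by simpa [hx] using hb, d, rfl, rfl⟩⟩
    rcases key with rfl | ⟨hU, d, hd, h⟩
    · exact self_mem_ball _ _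
    · exact Or.inr ⟨d, hd, ih _ h (by rw [Finset.card_erase_of_mem hU, hn]; rfl)⟩

/-- If a vertex of `T` is reachable from `x` at all, then the ball of radius `N` around `x` leaves
the ball of radius `N - 1` or meets `T`. -/
theorem exists_mem_ball_of_sameComponent {T : Set α} {x t : α} (ht : t ∈ T)
    (h : G.SameComponent x t) {N : ℕ} (hN : 0 < N) :
    ∃ y ∈ G.ball N x, y ∈ T ∪ (G.ball (N - 1) x)ᶜ := by
  by_contra! hc
  have hsub : G.ball N x ⊆ G.ball (N - 1) x := fun y hy => by
    by_contra hy'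
    exact hc y hy (Or.inr hy')
  have : t ∈ G.ball N x := by
    clear hc ht
    induction h with
    | refl => exact self_mem_ball _ _
    | tail _ hbc ih =>
      obtain ⟨d, rfl, rfl⟩ := exists_halfEdge_of_adj hbc
      have := head_mem_ball (hsub ih)
      rwa [Nat.sub_add_cancel hN] at this
  exact hc t this (Or.inl ht)

theorem mem_ball_card_of_sameComponent [Fintype V(G)] {x y : α} (h : G.SameComponent x y) :
    y ∈ G.ball (Fintype.card V(G)) x := by
  classical
  rw [← Set.toFinset_card]
  refine mem_ball_of_reflTransGen _ (Relation.ReflTransGen.mono (fun a b hab => ?_) _ _ h)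
  obtain ⟨d, rfl, rfl⟩ := exists_halfEdge_of_adj hab
  exact ⟨by simpa using G.tail_mem d, d, rfl, rfl⟩

end Ball

/-! ### Green functions -/

open Classical in
/-- The expected number of times that the walk from a given vertex traverses the half-edge `d`
during its first `k` steps and before it reaches `A`. -/
def green (G : Graph α β) [Fintype E(G)] (A : Set α) (d : G.HalfEdge) : ℕ → α → ℝ
  | 0, _ => 0
  | k + 1, x =>
    if x ∈ A then 0 else
      (∑ d' ∈ G.outHalfEdges x, ((if d' = d then 1 else 0) + green G A d k (G.head d'))) / G.deg x

variable {G : Graph α β} [Fintype E(G)] {A : Set α} {d : G.HalfEdge}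

theorem green_of_mem {x : α} (hx : x ∈ A) (k : ℕ) : G.green A d k x = 0 := by
  cases k <;> simp [green, hx]

theorem green_nonneg (k : ℕ) (x : α) : 0 ≤ G.green A d k x := by
  induction k generalizing x with
  | zero => exact le_rfl
  | succ k ih =>
    simp only [green]
    split_ifs
    · exact le_rfl
    · refine div_nonneg (Finset.sum_nonneg fun d' _ => add_nonneg ?_ (ih _)) (by positivity)
      split_ifs <;> norm_num

theorem green_le_succ (k : ℕ) (x : α) : G.green A d k x ≤ G.green A d (k + 1) x := by
  induction k generalizing x with
  | zero => exact green_nonneg _ _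
  | succ k ih =>
    rw [green, green]
    split_ifs
    · exact le_rfl
    · gcongr
      exact ih _

theorem average_le {x : α} {F : G.HalfEdge → ℝ} {c : ℝ} (hc : 0 ≤ c)
    (h : ∀ d ∈ G.outHalfEdges x, F d ≤ c) :
    (∑ d ∈ G.outHalfEdges x, F d) / G.deg x ≤ c := by
  refine div_le_of_le_mul₀ (by positivity) hc ?_
  rw [mul_comm, ← nsmul_eq_mul]
  exact Finset.sum_le_card_nsmul _ _ _ h

theorem green_le_green_tail (k : ℕ) (x : α) : G.green A d k x ≤ G.green A d k (G.tail d) := by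
  induction k generalizing x with
  | zero => exact le_rfl
  | succ k ih =>
    by_cases hx : x = G.tail d
    · rw [hx]
    · refine le_trans ?_ (green_le_succ k _)
      rw [green]
      split_ifs
      · exact green_nonneg _ _
      · refine average_le (green_nonneg _ _) fun d' hd' => ?_
        have : d' ≠ d := by
          rintro rfl
          exact hx (G.mem_outHalfEdges.1 hd').symm
        rw [if_neg this, zero_add]
        exact ih _

/-- Half-edges grouped by their tails. -/
theorem sum_filter_tail (P : α → Prop) [DecidablePred P] [DecidableEq α] (F : G.HalfEdge → ℝ) :
    ∑ d with P (G.tail d), F d =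
      ∑ x ∈ (Finset.univ.filter fun d => P (G.tail d)).image G.tail,
        ∑ d ∈ G.outHalfEdges x, F d := by
  rw [← Finset.sum_fiberwise_of_maps_to (s := Finset.univ.filter fun d => P (G.tail d))
    (g := G.tail) fun d hd => Finset.mem_image_of_mem _ hd]
  refine Finset.sum_congr rfl fun x hx => Finset.sum_congr ?_ fun _ _ => rfl
  obtain ⟨d, hd, rfl⟩ := Finset.mem_image.1 hx
  ext d'
  simp only [Finset.mem_filter, Finset.mem_univ, true_and, mem_outHalfEdges] at hd ⊢
  exact ⟨fun h => h.2, fun h => ⟨h ▸ hd, h⟩⟩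

/-- Along no half-edge does the Green function drop by more than one: it is the voltage of a
current of total strength at most one. All of the current that leaves the set
`{x | θ ≤ green x}`, for `θ > 0`, flows outwards, so no single half-edge carries more than one. -/
theorem green_tail_sub_green_head_le (k : ℕ) (d₀ : G.HalfEdge) :
    G.green A d k (G.tail d₀) - G.green A d k (G.head d₀) ≤ 1 := by
  classical
  set f := G.green A d k with hf
  by_cases hle : f (G.tail d₀) ≤ f (G.head d₀)
  · linarith
  push Not at hle
  set θ := f (G.tail d₀) with hθ
  have hθ0 : 0 < θ := (green_nonneg _ _).trans_lt hle
  let φ : α → ℝ := fun x => if θ ≤ f x then 1 else 0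
  -- the total current out of the level set
  have hout : ∑ d', φ (G.tail d') * (f (G.tail d') - f (G.head d')) ≤ 1 := by
    have h1 : ∑ d' with θ ≤ f (G.tail d'), f (G.tail d') ≤
        ∑ d' with θ ≤ f (G.tail d'), ((if d' = d then 1 else 0) + f (G.head d')) := by
      rw [sum_filter_tail (fun x => θ ≤ f x), sum_filter_tail (fun x => θ ≤ f x)]
      refine Finset.sum_le_sum fun x hx => ?_
      obtain ⟨d', hd', rfl⟩ := Finset.mem_image.1 hx
      simp only [Finset.mem_filter, Finset.mem_univ, true_and] at hd'
      have hA : G.tail d' ∉ A := fun h => by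
        have : f (G.tail d') = 0 := green_of_mem h k
        linarith
      have hpos : (0 : ℝ) < G.deg (G.tail d') := by exact_mod_cast G.deg_tail_pos d'
      have h2 := green_le_succ (A := A) (d := d) k (G.tail d')
      rw [green, if_neg hA, le_div_iff₀ hpos] at h2
      refine le_trans (le_of_eq ?_) h2
      rw [Finset.sum_congr rfl (g := fun _ => f (G.tail d')), Finset.sum_const, nsmul_eq_mul,
        mul_comm]
      · rfl
      · intro d'' h''
        rw [G.mem_outHalfEdges.1 h'']
    have h3 : ∑ d' with θ ≤ f (G.tail d'), (if d' = d then (1 : ℝ) else 0) ≤ 1 := by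
      rw [Finset.sum_ite_eq']
      split_ifs <;> norm_num
    rw [Finset.sum_add_distrib] at h1
    have h4 : ∑ d', φ (G.tail d') * (f (G.tail d') - f (G.head d')) =
        ∑ d' with θ ≤ f (G.tail d'), (f (G.tail d') - f (G.head d')) := by
      rw [Finset.sum_filter]
      refine Finset.sum_congr rfl fun d' _ => ?_
      simp only [φ]
      split_ifs <;> ring
    rw [h4, Finset.sum_sub_distrib]
    linarith
  have hrev : ∑ d', φ (G.head d') * (f (G.head d') - f (G.tail d')) =
      ∑ d', φ (G.tail d') * (f (G.tail d') - f (G.head d')) := by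
    rw [← Equiv.sum_comp G.reverse]; simp
  let ψ : G.HalfEdge → ℝ := fun d' =>
    (φ (G.tail d') - φ (G.head d')) * (f (G.tail d') - f (G.head d'))
  have hψ : ∀ d', 0 ≤ ψ d' := by
    intro d'
    simp only [ψ, φ]
    split_ifs <;> nlinarith
  have hψ0 : ψ d₀ = θ - f (G.head d₀) := by
    simp only [ψ, φ]
    rw [if_pos hθ.le, if_neg (not_le.2 hle)]
    ring
  have hψ1 : ψ (G.reverse d₀) = θ - f (G.head d₀) := by
    rw [← hψ0]; simp only [ψ, tail_reverse, head_reverse]; ring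
  have hne : d₀ ≠ G.reverse d₀ := fun h => by
    have := congrArg Prod.snd h
    simp [reverse] at this
  have hsum : ψ d₀ + ψ (G.reverse d₀) ≤ ∑ d', ψ d' := by
    rw [← Finset.sum_pair hne]
    exact Finset.sum_le_sum_of_subset_of_nonneg (Finset.subset_univ _) fun d' _ _ => hψ d'
  have htot : ∑ d', ψ d' = ∑ d', φ (G.tail d') * (f (G.tail d') - f (G.head d')) +
      ∑ d', φ (G.head d') * (f (G.head d') - f (G.tail d')) := by
    rw [← Finset.sum_add_distrib]
    exact Finset.sum_congr rfl fun d' _ => by simp only [ψ]; ring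
  linarith

theorem green_le_add_of_mem_ball {k j : ℕ} {x y : α} (h : y ∈ G.ball j x) :
    G.green A d k x ≤ G.green A d k y + j := by
  induction j generalizing x with
  | zero => rw [h]; simp
  | succ j ih =>
    rcases h with rfl | ⟨d', rfl, h⟩
    · linarith [(Nat.cast_nonneg (j + 1) : (0 : ℝ) ≤ _)]
    · have := green_tail_sub_green_head_le (A := A) (d := d) k d'
      push_cast
      linarith [ih h]

/-- The expected number of traversals of `d` before reaching `A` is at most the distance of `A`
from the tail of `d`. -/
theorem green_le_of_mem_ball {k j : ℕ} {y : α} (hy : y ∈ A) (h : y ∈ G.ball j (G.tail d)) (x : α) :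
    G.green A d k x ≤ j := by
  refine (green_le_green_tail k x).trans ((green_le_add_of_mem_ball h).trans ?_)
  rw [green_of_mem hy, zero_add]

end GreenFunction

section Exploration

/-! ### Probabilities of events of the random walk -/

/-- The probability that the random walk with `k` steps from `x` lies in `A`. -/
def walkProb (G : Graph α β) [Fintype E(G)] (k : ℕ) (x : α) (A : Set (List G.HalfEdge)) : ℝ :=
  G.walkExp k x (A.indicator 1)

/-- The walk `w` from `x` visits no vertex of `T`. -/
def Avoids (G : Graph α β) (T : Set α) : α → List G.HalfEdge → Prop
  | x, [] => x ∉ T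
  | x, d :: w => x ∉ T ∧ Avoids G T (G.head d) w

/-- Some vertex of `T` lies in the connected component of `x`. -/
def Reaches (G : Graph α β) (T : Set α) (x : α) : Prop := ∃ t ∈ T, G.SameComponent x t

section Deterministic

variable {G : Graph α β} {T : Set α}

theorem Reaches.head {d : G.HalfEdge} (h : G.Reaches T (G.tail d)) : G.Reaches T (G.head d) := by
  obtain ⟨t, ht, h⟩ := h
  exact ⟨t, ht, .head (G.adj_tail_head d).symm h⟩

theorem Reaches.endVertex {x : α} (h : G.Reaches T x) {w : List G.HalfEdge}
    (hw : G.IsWalkFrom x w) : G.Reaches T (G.endVertex x w) := by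
  induction w generalizing x with
  | nil => exact h
  | cons d w ih =>
    obtain ⟨rfl, hw⟩ := hw
    exact ih h.head hw

theorem Avoids.notMem {x : α} {w : List G.HalfEdge} (h : G.Avoids T x w) : x ∉ T := by
  cases w
  · exact h
  · exact h.1

theorem avoids_append {x : α} {w w' : List G.HalfEdge} :
    G.Avoids T x (w ++ w') ↔ G.Avoids T x w ∧ G.Avoids T (G.endVertex x w) w' := by
  induction w generalizing x with
  | nil => exact ⟨fun h => ⟨h.notMem, h⟩, fun h => h.2⟩
  | cons d w ih =>
    simp only [List.cons_append, Avoids, Graph.endVertex, ih, and_assoc]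

theorem Avoids.head_notMem {x : α} {w : List G.HalfEdge} (h : G.Avoids T x w) {d : G.HalfEdge}
    (hd : d ∈ w) : G.head d ∉ T := by
  induction w generalizing x with
  | nil => simp at hd
  | cons d' w ih =>
    rcases List.mem_cons.1 hd with rfl | hd
    · exact h.2.notMem
    · exact ih h.2 hd

theorem avoids_of_endVertex_stopAt_notMem {x : α} {w : List G.HalfEdge}
    (h : G.endVertex x (G.stopAt T x w) ∉ T) : G.Avoids T x w := by
  induction w generalizing x with
  | nil => exact h
  | cons d w ih =>
    by_cases hx : x ∈ T
    · rw [stopAt, if_pos hx] at h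
      exact absurd hx h
    · simp only [stopAt, hx, if_false, Graph.endVertex] at h
      exact ⟨hx, ih h⟩

theorem stopAt_subset {x : α} {w : List G.HalfEdge} : G.stopAt T x w ⊆ w := by
  induction w generalizing x with
  | nil => simp [stopAt]
  | cons d w ih =>
    simp only [stopAt]
    split_ifs
    · simp
    · exact List.cons_subset_cons _ ih

end Deterministic

variable {G : Graph α β} [Fintype E(G)] {T : Set α}

theorem walkProb_le_one (k : ℕ) (x : α) (A : Set (List G.HalfEdge)) : G.walkProb k x A ≤ 1 :=
  walkExp_le _ _ fun _ => Set.indicator_apply_le' (fun _ => le_rfl) fun _ => zero_le_one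

theorem walkProb_mono {k : ℕ} {x : α} {A B : Set (List G.HalfEdge)}
    (h : ∀ w, G.IsWalkFrom x w → w ∈ A → w ∈ B) : G.walkProb k x A ≤ G.walkProb k x B := by
  refine walkExp_mono _ _ fun w hw => ?_
  by_cases hA : w ∈ A
  · simp [hA, h w hw hA]
  · simp only [hA, not_false_eq_true, Set.indicator_of_notMem]
    exact Set.indicator_nonneg (fun _ _ => zero_le_one) _

theorem walkProb_eq_zero {k : ℕ} {x : α} {A : Set (List G.HalfEdge)} (h : ∀ w, w ∉ A) :
    G.walkProb k x A = 0 := by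
  rw [walkProb, Set.eq_empty_iff_forall_notMem.2 h, Set.indicator_empty]
  exact walkExp_const k x 0

theorem walkProb_succ {x : α} (hx : (G.outHalfEdges x).Nonempty) (k : ℕ)
    (A : Set (List G.HalfEdge)) :
    G.walkProb (k + 1) x A =
      (∑ d ∈ G.outHalfEdges x, G.walkProb k (G.head d) {w | d :: w ∈ A}) / G.deg x := by
  rw [walkProb, walkExp, if_pos hx]
  rfl

theorem walkProb_steps_add_le {s k : ℕ} {x : α} {A B : Set (List G.HalfEdge)} {q : ℝ}
    (hA : ∀ w w', G.IsWalkFrom x w → w ++ w' ∈ A → w ∈ B)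
    (h : ∀ w ∈ B, G.IsWalkFrom x w → G.walkProb k (G.endVertex x w) {w' | w ++ w' ∈ A} ≤ q) :
    G.walkProb (s + k) x A ≤ G.walkProb s x B * q := by
  rw [walkProb, walkExp_steps_add, walkProb, ← walkExp_mul_right]
  refine walkExp_mono _ _ fun w hw => ?_
  by_cases hB : w ∈ B
  · rw [Set.indicator_of_mem hB, Pi.one_apply, one_mul]
    exact h w hB hw
  · rw [Set.indicator_of_notMem hB, zero_mul]
    exact (walkProb_eq_zero (A := {w' | w ++ w' ∈ A}) fun w' hw' => hB (hA w w' hw hw')).le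

theorem Reaches.outHalfEdges_nonempty {x : α} (h : G.Reaches T x) (hx : x ∉ T) :
    (G.outHalfEdges x).Nonempty := by
  obtain ⟨t, ht, h⟩ := h
  rcases h.cases_head with rfl | ⟨y, hy, _⟩
  · exact absurd ht hx
  · obtain ⟨d, hd, _⟩ := exists_halfEdge_of_adj hy
    exact ⟨d, by simpa using hd⟩

/-! ### Exploration by the random walk -/

/-- One step of the walk in the comparison of the expected number of steps with a sum of Green
functions. -/
theorem add_one_mul_average_le {x : α} (hx : (G.outHalfEdges x).Nonempty) {k : ℕ}
    {p : G.HalfEdge → ℝ} (hp : ∀ d, p d ≤ 1) {D : Finset G.HalfEdge} {A : G.HalfEdge → Set α}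
    (hA : ∀ d ∈ D, x ∉ A d) {c : ℝ} [DecidableEq G.HalfEdge]
    (h : ∀ d' ∈ G.outHalfEdges x, k * p d' + 1 ≤
      ∑ d ∈ D, ((if d' = d then 1 else 0) + G.green (A d) d k (G.head d')) + c) :
    ((k + 1 : ℕ) : ℝ) * ((∑ d' ∈ G.outHalfEdges x, p d') / G.deg x) ≤
      ∑ d ∈ D, G.green (A d) d (k + 1) x + c := by
  have hdeg : (0 : ℝ) < G.deg x := by exact_mod_cast Finset.card_pos.2 hx
  have h1 : ∑ d ∈ D, G.green (A d) d (k + 1) x =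
      (∑ d' ∈ G.outHalfEdges x,
        ∑ d ∈ D, ((if d' = d then 1 else 0) + G.green (A d) d k (G.head d'))) / G.deg x := by
    rw [Finset.sum_comm, Finset.sum_div]
    refine Finset.sum_congr rfl fun d hd => ?_
    rw [green, if_neg (hA d hd)]
    simp only [Finset.sum_add_distrib]
    congr!
  have h2 : ∑ d' ∈ G.outHalfEdges x, ((k + 1 : ℕ) : ℝ) * p d' ≤ ∑ d' ∈ G.outHalfEdges x,
      (∑ d ∈ D, ((if d' = d then 1 else 0) + G.green (A d) d k (G.head d')) + c) := by
    refine Finset.sum_le_sum fun d' hd' => le_trans ?_ (h d' hd')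
    push_cast
    linarith [hp d']
  rw [h1, ← mul_div_assoc, Finset.mul_sum, div_add' _ _ _ hdeg.ne']
  gcongr
  refine h2.trans (le_of_eq ?_)
  rw [Finset.sum_add_distrib, Finset.sum_const, nsmul_eq_mul, mul_comm c]
  rfl

open Classical in
/-- The walks from `x` that avoid `T` and that, together with `H`, use fewer than `N`
half-edges. -/
def confined (G : Graph α β) (T : Set α) (N : ℕ) (x : α) (H : Finset G.HalfEdge) :
    Set (List G.HalfEdge) :=
  {w | G.Avoids T x w ∧ (H ∪ w.toFinset).card < N}

open Classical in
/-- The invariant of the exploration, when the half-edges of `H` have been discovered already and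
the walk is at `x`: each `d ∈ H` accounts for its remaining traversals, and each of the
`N - H.card` half-edges still to be discovered for at most `1 + N` traversals, the first one
included. By `hH`, the walk is still inside the ball around the tail of each `d ∈ H` in which the
Green function of `d` counts. -/
theorem mul_walkProb_confined_le_sum_green {N : ℕ} (hN : 0 < N) (k : ℕ) {x : α}
    {H : Finset G.HalfEdge} (hx : G.Reaches T x) (hcard : H.card ≤ N)
    (hH : ∀ d ∈ H, Relation.ReflTransGen (G.StepFrom (H.image G.tail : Finset α)) (G.tail d) x) :
    k * G.walkProb k x (G.confined T N x H) ≤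
      ∑ d ∈ H, G.green (T ∪ (G.ball (N - 1) (G.tail d))ᶜ) d k x +
        ((N : ℝ) - H.card) * (1 + N) := by
  induction k generalizing x H with
  | zero =>
    have : (H.card : ℝ) ≤ N := by exact_mod_cast hcard
    simp only [green, Finset.sum_const_zero, Nat.cast_zero, zero_mul, zero_add]
    exact mul_nonneg (by linarith) (by positivity)
  | succ k ih =>
    have hnonneg : 0 ≤ ∑ d ∈ H, G.green (T ∪ (G.ball (N - 1) (G.tail d))ᶜ) d (k + 1) x +
        ((N : ℝ) - H.card) * (1 + N) := by
      have : (H.card : ℝ) ≤ N := by exact_mod_cast hcard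
      exact add_nonneg (Finset.sum_nonneg fun d _ => green_nonneg _ _)
        (mul_nonneg (by linarith) (by positivity))
    by_cases hxT : x ∈ T
    · rw [walkProb_eq_zero fun w hw => hw.1.notMem hxT, mul_zero]
      exact hnonneg
    by_cases hHN : H.card < N
    swap
    · rw [walkProb_eq_zero fun w hw => ?_, mul_zero]
      · exact hnonneg
      · exact hHN ((Finset.card_le_card Finset.subset_union_left).trans_lt hw.2)
    have hout := hx.outHalfEdges_nonempty hxT
    rw [walkProb_succ hout]
    refine add_one_mul_average_le hout (fun d => walkProb_le_one _ _ _) ?_ ?_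
    · rintro d hd (h | h)
      · exact hxT h
      · refine h (ball_mono ?_ _ (mem_ball_of_reflTransGen _ (hH d hd)))
        have := Finset.card_image_le (s := H) (f := G.tail)
        omega
    intro d' hd'
    rw [mem_outHalfEdges] at hd'
    subst hd'
    have hset : {w | d' :: w ∈ G.confined T N (G.tail d') H} =
        G.confined T N (G.head d') (insert d' H) := by
      ext w
      simp only [confined, Set.mem_ofPred_eq, Avoids, hxT, not_false_eq_true, true_and,
        List.toFinset_cons, Finset.union_insert, Finset.insert_union]
    rw [hset]
    have hcard' : (insert d' H).card ≤ N := (Finset.card_insert_le _ _).trans hHN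
    have hstep : G.StepFrom ((insert d' H).image G.tail : Finset α) (G.tail d') (G.head d') :=
      ⟨by simp, d', rfl, rfl⟩
    have hpath : ∀ d ∈ insert d' H, Relation.ReflTransGen
        (G.StepFrom ((insert d' H).image G.tail : Finset α)) (G.tail d) (G.head d') := by
      intro d hd
      rcases Finset.mem_insert.1 hd with rfl | hd
      · exact .single hstep
      · refine .tail (Relation.ReflTransGen.mono (fun a b hab => ⟨?_, hab.2⟩) _ _ (hH d hd)) hstep
        exact Finset.image_subset_image (Finset.subset_insert _ _) hab.1
    have hih := ih hx.head hcard' hpath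
    by_cases hmem : d' ∈ H
    · rw [Finset.insert_eq_of_mem hmem] at hih ⊢
      rw [Finset.sum_add_distrib, Finset.sum_ite_eq, if_pos hmem]
      linarith
    · rw [Finset.sum_insert hmem, Finset.card_insert_of_notMem hmem] at hih
      rw [Finset.sum_add_distrib, Finset.sum_ite_eq, if_neg hmem]
      obtain ⟨t, ht, hxt⟩ := hx
      obtain ⟨y, hy, hyA⟩ := exists_mem_ball_of_sameComponent ht hxt hN
      have hg := green_le_of_mem_ball (d := d') (k := k) hyA hy (G.head d')
      push_cast at hih
      linarith

/-- If the component of `x` contains a vertex of `T`, then within about `N ^ 2` steps the walk from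
`x` reaches `T` or uses `N` half-edges: each of the first `N` half-edges that it discovers is
traversed at most `N + 1` times on average. -/
theorem mul_walkProb_confined_le {N : ℕ} (hN : 0 < N) (k : ℕ) {x : α} (hx : G.Reaches T x) :
    k * G.walkProb k x (G.confined T N x ∅) ≤ N * (1 + N) := by
  have := mul_walkProb_confined_le_sum_green hN k (H := ∅) hx (by simp) (by simp)
  simpa using this

/-- Repetition of `mul_walkProb_confined_le` over `k` blocks of `t` steps. -/
theorem walkProb_confined_le_pow {N : ℕ} {t : ℕ} {q : ℝ} (hq : 0 ≤ q)
    (h : ∀ x, G.Reaches T x → G.walkProb t x (G.confined T N x ∅) ≤ q) (k r : ℕ) {x : α}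
    (hx : G.Reaches T x) : G.walkProb (t * k + r) x (G.confined T N x ∅) ≤ q ^ k := by
  classical
  induction k generalizing x with
  | zero => exact (walkProb_le_one _ _ _)
  | succ k ih =>
    rw [Nat.mul_succ, Nat.add_right_comm, Nat.add_comm (t * k + r), pow_succ, mul_comm (q ^ k)]
    refine (walkProb_steps_add_le (B := G.confined T N x ∅) (q := q ^ k) ?_ ?_).trans (mul_le_mul_of_nonneg_right (h x hx) (by positivity))
    · intro w w' _ hw
      refine ⟨(avoids_append.1 hw.1).1, lt_of_le_of_lt (Finset.card_le_card ?_) hw.2⟩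
      simp
    · intro w _ hw
      refine (walkProb_mono fun w' _ hw' => ?_).trans (ih (hx.endVertex hw))
      refine ⟨(avoids_append.1 hw'.1).2, lt_of_le_of_lt (Finset.card_le_card ?_) hw'.2⟩
      simp

open Classical in
/-- The hitting time of `T` is on average at most the number of vertices times the number of
half-edges outside `T`. -/
theorem mul_walkProb_avoids_le [Fintype V(G)] (k : ℕ) {x : α} (hx : G.Reaches T x) :
    k * G.walkProb k x {w | G.Avoids T x w} ≤
      (Finset.univ.filter fun d : G.HalfEdge => G.tail d ∉ T).card * Fintype.card V(G) := by
  set D : Finset G.HalfEdge := Finset.univ.filter fun d => G.tail d ∉ T ∧ G.Reaches T (G.tail d)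
    with hD
  have key : ∀ x, G.Reaches T x → k * G.walkProb k x {w | G.Avoids T x w} ≤
      ∑ d ∈ D, G.green T d k x + 0 := by
    induction k with
    | zero => intro x _; simp [green]
    | succ k ih =>
      intro x hx
      by_cases hxT : x ∈ T
      · rw [walkProb_eq_zero (A := {w | G.Avoids T x w}) fun w hw => Avoids.notMem hw hxT,
          mul_zero, add_zero]
        exact Finset.sum_nonneg fun d _ => green_nonneg _ _
      have hout := hx.outHalfEdges_nonempty hxT
      rw [walkProb_succ hout]
      refine add_one_mul_average_le hout (fun d => walkProb_le_one _ _ _) (fun _ _ => hxT) ?_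
      intro d' hd'
      rw [mem_outHalfEdges] at hd'
      subst hd'
      have hset : {w | d' :: w ∈ {w | G.Avoids T (G.tail d') w}} =
          {w | G.Avoids T (G.head d') w} := by
        ext w
        simp [Avoids, hxT]
      have hmem : d' ∈ D := by simp [hD, hxT, hx]
      rw [hset, Finset.sum_add_distrib, Finset.sum_ite_eq, if_pos hmem]
      linarith [ih _ hx.head]
  refine (key x hx).trans ?_
  rw [add_zero]
  have hg : ∀ d ∈ D, G.green T d k x ≤ Fintype.card V(G) := by
    intro d hd
    obtain ⟨_, t, ht, hdt⟩ := (Finset.mem_filter.1 hd).2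
    exact green_le_of_mem_ball ht (mem_ball_card_of_sameComponent hdt) x
  refine (Finset.sum_le_card_nsmul _ _ _ hg).trans ?_
  rw [nsmul_eq_mul]
  gcongr
  exact Finset.monotone_filter_right _ fun d _ hd => hd.1

theorem walkProb_avoids_le_pow {t : ℕ} {q : ℝ} (hq : 0 ≤ q)
    (h : ∀ x, G.Reaches T x → G.walkProb t x {w | G.Avoids T x w} ≤ q) (k r : ℕ) {x : α}
    (hx : G.Reaches T x) : G.walkProb (t * k + r) x {w | G.Avoids T x w} ≤ q ^ k := by
  -- a bound on the number of half-edges that is never attained imposes no condition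
  have hset : ∀ y, {w | G.Avoids T y w} = G.confined T (Fintype.card G.HalfEdge + 1) y ∅ :=
    fun y => Set.ext fun w => ⟨fun hw => ⟨hw, Nat.lt_succ_of_le (Finset.card_le_univ _)⟩,
      fun hw => hw.1⟩
  simp only [hset] at h ⊢
  exact walkProb_confined_le_pow hq h k r hx

end Exploration

section Experiment

/-! ### The experiment -/

theorem eq_false_of_tail_notMem {G : Graph α β} {S : E(G) → Bool} {d : G.HalfEdge}
    (h : G.tail d ∉ G.terminals S) : S d.1 = false := by
  by_contra hS
  exact h ⟨d.1, by simpa using hS, (G.isLink_tail_head d).inc_left⟩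

theorem eq_false_of_head_notMem {G : Graph α β} {S : E(G) → Bool} {d : G.HalfEdge}
    (h : G.head d ∉ G.terminals S) : S d.1 = false := by
  exact eq_false_of_tail_notMem (d := G.reverse d) (by rwa [tail_reverse])

theorem Misses.reaches {G : Graph α β} {r : ℕ} {ω : G.ShortedOutcome r} {j : G.HalfEdge × Fin r} (h : G.Misses ω j) :
    G.Reaches (G.terminals ω.1) (G.tail j.1) := h.1

theorem Misses.avoids {G : Graph α β} {r : ℕ} {ω : G.ShortedOutcome r} {j : G.HalfEdge × Fin r} (h : G.Misses ω j) :
    G.Avoids (G.terminals ω.1) (G.tail j.1) (ω.2 j) :=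
  avoids_of_endVertex_stopAt_notMem h.2

variable {G : Graph α β} [Fintype E(G)]

/-- The law of the selected edges. -/
abbrev selectionLaw (G : Graph α β) [Fintype E(G)] (p : E(G) → unitInterval) :
    Measure (E(G) → Bool) :=
  Measure.pi fun e => ProbabilityTheory.bernoulliMeasure true false (p e)

theorem selectionLaw_forall_eq_false_le {p : E(G) → unitInterval} {b : ℝ}
    (hp : ∀ e, b ≤ (p e : ℝ)) (hb : 0 ≤ b) (D : Finset G.HalfEdge) :
    G.selectionLaw p {S | ∀ d ∈ D, S d.1 = false} ≤
      ENNReal.ofReal (Real.exp (-(b * D.card / 2))) := by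
  classical
  set F := D.image Prod.fst with hF
  have hset : {S : E(G) → Bool | ∀ d ∈ D, S d.1 = false} =
      Set.univ.pi fun e => if e ∈ F then {false} else Set.univ := by
    ext S
    simp only [Set.mem_ofPred_eq, Set.mem_pi, Set.mem_univ, true_imp_iff]
    constructor
    · intro h e
      split_ifs with he
      · obtain ⟨d, hd, rfl⟩ := Finset.mem_image.1 he
        exact h d hd
      · trivial
    · intro h d hd
      have := h d.1
      rwa [if_pos (Finset.mem_image_of_mem _ hd)] at this
  have hfac : ∀ e, ProbabilityTheory.bernoulliMeasure true false (p e)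
      (if e ∈ F then {false} else Set.univ) ≤
        if e ∈ F then ENNReal.ofReal (Real.exp (-b)) else 1 := by
    intro e
    split_ifs
    · rw [ProbabilityTheory.bernoulliMeasure_apply_of_notMem_of_mem (s := {false}) _ (by simp) (by simp)
        (by simp), ENNReal.ofReal, ENNReal.coe_le_coe]
      refine NNReal.coe_le_coe.1 ?_
      rw [Real.coe_toNNReal _ (Real.exp_pos _).le]
      have h1 := Real.add_one_le_exp (-b)
      have h2 : ((unitInterval.toNNReal (unitInterval.symm (p e)) : NNReal) : ℝ) = 1 - p e := by
        simp
      rw [h2]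
      linarith [hp e]
    · exact prob_le_one
  -- every edge carries only two half-edges
  have hcard : D.card ≤ 2 * F.card := by
    refine (Finset.card_le_card (t := F ×ˢ (Finset.univ : Finset Bool)) fun d hd => ?_).trans ?_
    · exact Finset.mem_product.2 ⟨Finset.mem_image_of_mem _ hd, Finset.mem_univ _⟩
    · simp [mul_comm]
  rw [selectionLaw, hset, Measure.pi_pi]
  refine (Finset.prod_le_prod' fun e _ => hfac e).trans ?_
  rw [Finset.prod_ite_mem, Finset.univ_inter, Finset.prod_const,
    ← ENNReal.ofReal_pow (Real.exp_pos _).le, ← Real.exp_nat_mul]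
  refine ENNReal.ofReal_le_ofReal (Real.exp_le_exp.2 ?_)
  have : (D.card : ℝ) ≤ 2 * F.card := by exact_mod_cast hcard
  nlinarith

variable {p : E(G) → unitInterval} {L r : ℕ}

theorem shortedLaw_fst (A : Set (E(G) → Bool)) :
    G.shortedLaw p L r {ω | ω.1 ∈ A} = G.selectionLaw p A :=
  measurePreserving_fst.measure_preimage (MeasurableSet.of_discrete).nullMeasurableSet

/-- The marginal law of the selection together with one of the walks. -/
theorem shortedLaw_selection_walk (j : G.HalfEdge × Fin r)
    (Q : Set ((E(G) → Bool) × List G.HalfEdge)) :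
    G.shortedLaw p L r {ω | (ω.1, ω.2 j) ∈ Q} =
      ((G.selectionLaw p).prod (G.walkLaw L (G.tail j.1)).toMeasure) Q :=
  ((MeasurePreserving.id _).prod (measurePreserving_eval
    (fun j : G.HalfEdge × Fin r => (G.walkLaw L (G.tail j.1)).toMeasure) j)).measure_preimage
    (MeasurableSet.of_discrete).nullMeasurableSet

/-- A bound that holds for the walk, given any selection. -/
theorem shortedLaw_le_of_walkProb_le {j : G.HalfEdge × Fin r}
    {Q : (E(G) → Bool) → Set (List G.HalfEdge)} {q : ℝ}
    (h : ∀ S, G.walkProb L (G.tail j.1) (Q S) ≤ q) :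
    G.shortedLaw p L r {ω | ω.2 j ∈ Q ω.1} ≤ ENNReal.ofReal q := by
  refine (shortedLaw_selection_walk j {y | y.2 ∈ Q y.1}).trans_le ?_
  rw [Measure.prod_apply (.of_discrete)]
  refine (lintegral_mono (g := fun _ => ENNReal.ofReal q) fun S => ?_).trans (by simp)
  exact (walkLaw_toMeasure_apply _ _ _).trans_le (ENNReal.ofReal_le_ofReal (h S))

/-- A bound that holds for the selection, given any walk. -/
theorem shortedLaw_le_of_selectionLaw_le {j : G.HalfEdge × Fin r}
    {Q : List G.HalfEdge → Set (E(G) → Bool)} {q : ENNReal}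
    (h : ∀ w, G.selectionLaw p (Q w) ≤ q) :
    G.shortedLaw p L r {ω | ω.1 ∈ Q (ω.2 j)} ≤ q := by
  refine (shortedLaw_selection_walk j {y | y.1 ∈ Q y.2}).trans_le ?_
  rw [Measure.prod_apply_symm (.of_discrete)]
  refine (lintegral_mono (g := fun _ => q) fun w => ?_).trans (by simp)
  exact h w

/-- A walk that misses the terminals either discovers fewer than `N` half-edges although a terminal
is reachable, or it discovers `N` half-edges none of whose edges is selected. -/
theorem shortedLaw_misses_le {b : ℝ} (hp : ∀ e, b ≤ (p e : ℝ)) (hb : 0 ≤ b) (N : ℕ) {q : ℝ}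
    (hq : 0 ≤ q)
    (h : ∀ T x, G.Reaches T x → G.walkProb L x (G.confined T N x ∅) ≤ q)
    (j : G.HalfEdge × Fin r) :
    G.shortedLaw p L r {ω | G.Misses ω j} ≤
      ENNReal.ofReal q + ENNReal.ofReal (Real.exp (-(b * N / 2))) := by
  classical
  set x := G.tail j.1 with hx
  have hsub : {ω : G.ShortedOutcome r | G.Misses ω j} ⊆
      {ω | ω.2 j ∈ {w | G.Reaches (G.terminals ω.1) x ∧ w ∈ G.confined (G.terminals ω.1) N x ∅}} ∪
      {ω | ω.1 ∈ {S | N ≤ (ω.2 j).toFinset.card ∧ ∀ d ∈ (ω.2 j).toFinset, S d.1 = false}} := by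
    intro ω hω
    by_cases hc : (ω.2 j).toFinset.card < N
    · refine Or.inl ⟨hω.reaches, hω.avoids, ?_⟩
      rw [Finset.empty_union]
      convert hc
    · refine Or.inr ⟨not_lt.1 hc, fun d hd => ?_⟩
      exact eq_false_of_head_notMem (hω.avoids.head_notMem (by simpa using hd))
  refine (measure_mono hsub).trans ((measure_union_le _ _).trans (add_le_add ?_ ?_))
  · refine shortedLaw_le_of_walkProb_le (Q := fun S =>
      {w | G.Reaches (G.terminals S) x ∧ w ∈ G.confined (G.terminals S) N x ∅}) fun S => ?_
    by_cases hS : G.Reaches (G.terminals S) x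
    · exact (walkProb_mono fun w _ hw => hw.2).trans (h _ _ hS)
    · refine (walkProb_eq_zero (A := {w | G.Reaches (G.terminals S) x ∧
        w ∈ G.confined (G.terminals S) N x ∅}) fun w hw => hS hw.1).trans_le hq
  · refine shortedLaw_le_of_selectionLaw_le (Q := fun w =>
      {S | N ≤ w.toFinset.card ∧ ∀ d ∈ w.toFinset, S d.1 = false}) fun w => ?_
    by_cases hw : N ≤ w.toFinset.card
    · refine (measure_mono fun S hS => hS.2).trans
        ((selectionLaw_forall_eq_false_le hp hb w.toFinset).trans ?_)
      refine ENNReal.ofReal_le_ofReal (Real.exp_le_exp.2 ?_)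
      gcongr
    · refine (measure_mono (t := ∅) fun S hS => hw hS.1).trans (by simp)

/-- All vertices of large degree are terminals, up to a small probability. -/
theorem shortedLaw_exists_deg_le [Fintype V(G)] {b : ℝ} (hp : ∀ e, b ≤ (p e : ℝ)) (hb : 0 ≤ b)
    {Δ : ℝ} (hΔ : 0 ≤ Δ) :
    G.shortedLaw p L r {ω | ∃ x, Δ < G.deg x ∧ x ∉ G.terminals ω.1} ≤
      ENNReal.ofReal (Fintype.card V(G) * Real.exp (-(b * Δ / 2))) := by
  refine (shortedLaw_fst {S | ∃ x, Δ < G.deg x ∧ x ∉ G.terminals S}).trans_le ?_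
  have hsub : {S | ∃ x, Δ < G.deg x ∧ x ∉ G.terminals S} ⊆
      ⋃ x : V(G), {S | Δ < G.deg x.1 ∧ ∀ d ∈ G.outHalfEdges x.1, S d.1 = false} := by
    rintro S ⟨x, hx, hxT⟩
    have hpos : 0 < G.deg x := by exact_mod_cast hΔ.trans_lt hx
    obtain ⟨d, hd⟩ := Finset.card_pos.1 hpos
    have hxV : x ∈ V(G) := G.mem_outHalfEdges.1 hd ▸ G.tail_mem d
    refine Set.mem_iUnion.2 ⟨⟨x, hxV⟩, hx, fun d hd => ?_⟩
    rw [mem_outHalfEdges] at hd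
    exact eq_false_of_tail_notMem (hd ▸ hxT)
  refine (measure_mono hsub).trans ((measure_iUnion_fintype_le _ _).trans ?_)
  refine (Finset.sum_le_card_nsmul _ _ (ENNReal.ofReal (Real.exp (-(b * Δ / 2)))) ?_).trans ?_
  · rintro x -
    by_cases hx : Δ < G.deg x.1
    · refine (measure_mono fun S hS => hS.2).trans
        ((selectionLaw_forall_eq_false_le hp hb (G.outHalfEdges x.1)).trans ?_)
      refine ENNReal.ofReal_le_ofReal (Real.exp_le_exp.2 ?_)
      have : Δ ≤ ((G.outHalfEdges x.1).card : ℝ) := hx.le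
      gcongr
    · refine (measure_mono (t := ∅) fun S hS => hx hS.1).trans (by simp)
  · rw [nsmul_eq_mul, ENNReal.ofReal_mul (by positivity), ENNReal.ofReal_natCast]
    rfl

theorem card_filter_tail_le [Fintype V(G)] {P : α → Prop} [DecidablePred P] {Δ : ℝ} (hΔ : 0 ≤ Δ)
    (h : ∀ x, P x → G.deg x ≤ Δ) :
    ((Finset.univ.filter fun d : G.HalfEdge => P (G.tail d)).card : ℝ) ≤
      Fintype.card V(G) * Δ := by
  have h1 := sum_deg_mul (G := G) fun x => if P x then 1 else 0
  rw [← Finset.sum_filter, Finset.sum_const, nsmul_eq_mul, mul_one] at h1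
  rw [← h1]
  refine (Finset.sum_le_card_nsmul _ _ Δ fun u _ => ?_).trans ?_
  · by_cases hu : P u
    · rw [if_pos hu, mul_one]
      exact h _ hu
    · rwa [if_neg hu, mul_zero]
  · rw [nsmul_eq_mul]; rfl

/-- A union bound over the walks that start at vertices of degree at most `Δ`; by
`shortedLaw_exists_deg_le`, walks from other vertices hardly ever matter. -/
theorem shortedLaw_exists_misses_le [Fintype V(G)] {b : ℝ} (hp : ∀ e, b ≤ (p e : ℝ)) (hb : 0 ≤ b)
    {Δ : ℝ} (hΔ : 0 ≤ Δ) {q : ℝ} (hq : 0 ≤ q)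
    (h : ∀ j : G.HalfEdge × Fin r, G.shortedLaw p L r
      {ω | G.Misses ω j ∧ ∀ x, Δ < G.deg x → x ∈ G.terminals ω.1} ≤ ENNReal.ofReal q) :
    G.shortedLaw p L r {ω | ∃ j, G.Misses ω j} ≤ ENNReal.ofReal
      (Fintype.card V(G) * Real.exp (-(b * Δ / 2)) + r * (Fintype.card V(G) * Δ) * q) := by
  classical
  let J : Finset (G.HalfEdge × Fin r) :=
    (Finset.univ.filter fun d : G.HalfEdge => (G.deg (G.tail d) : ℝ) ≤ Δ) ×ˢ Finset.univ
  have hJ : (J.card : ℝ) ≤ r * (Fintype.card V(G) * Δ) := by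
    simp only [J, Finset.card_product, Finset.card_univ, Fintype.card_fin, Nat.cast_mul]
    rw [mul_comm]
    gcongr
    exact card_filter_tail_le (P := fun x => (G.deg x : ℝ) ≤ Δ) hΔ fun _ hx => hx
  have hsub : {ω : G.ShortedOutcome r | ∃ j, G.Misses ω j} ⊆
      {ω | ∃ x, Δ < G.deg x ∧ x ∉ G.terminals ω.1} ∪
      ⋃ j ∈ J, {ω | G.Misses ω j ∧ ∀ x, Δ < G.deg x → x ∈ G.terminals ω.1} := by
    rintro ω ⟨j, hj⟩
    by_cases hω : ∃ x, Δ < G.deg x ∧ x ∉ G.terminals ω.1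
    · exact Or.inl hω
    · push Not at hω
      refine Or.inr (Set.mem_biUnion (x := j) ?_ ⟨hj, hω⟩)
      have : (G.deg (G.tail j.1) : ℝ) ≤ Δ :=
        not_lt.1 fun hlt => hj.avoids.notMem (hω _ hlt)
      simpa [J] using this
  refine (measure_mono hsub).trans ((measure_union_le _ _).trans ?_)
  rw [ENNReal.ofReal_add (by positivity) (by positivity)]
  refine add_le_add (shortedLaw_exists_deg_le hp hb hΔ) ?_
  refine (measure_biUnion_finset_le _ _).trans
    ((Finset.sum_le_card_nsmul _ _ _ fun j _ => h j).trans ?_)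
  rw [nsmul_eq_mul, ← ENNReal.ofReal_natCast, ← ENNReal.ofReal_mul (by positivity)]
  exact ENNReal.ofReal_le_ofReal (by gcongr)

/-- If all vertices of degree larger than `Δ` are terminals, at most `n * Δ` half-edges start
outside of the terminals, so that the hitting time is at most `n ^ 2 * Δ` on average. -/
theorem shortedLaw_misses_and_deg_le [Fintype V(G)] {Δ : ℝ} (hΔ : 0 ≤ Δ) {t : ℕ} (ht : 0 < t)
    (k s : ℕ) (hL : L = t * k + s) (j : G.HalfEdge × Fin r) :
    G.shortedLaw p L r {ω | G.Misses ω j ∧ ∀ x, Δ < G.deg x → x ∈ G.terminals ω.1} ≤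
      ENNReal.ofReal (((Fintype.card V(G) : ℝ) ^ 2 * Δ / t) ^ k) := by
  classical
  set q : ℝ := (Fintype.card V(G) : ℝ) ^ 2 * Δ / t with hq
  let P : (E(G) → Bool) → Prop := fun S =>
    G.Reaches (G.terminals S) (G.tail j.1) ∧ ∀ x, Δ < G.deg x → x ∈ G.terminals S
  refine (measure_mono (t := {ω | ω.2 j ∈
    {w | P ω.1 ∧ G.Avoids (G.terminals ω.1) (G.tail j.1) w}}) fun ω hω =>
      ⟨⟨hω.1.reaches, hω.2⟩, hω.1.avoids⟩).trans ?_
  refine shortedLaw_le_of_walkProb_le (Q := fun S =>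
    {w | P S ∧ G.Avoids (G.terminals S) (G.tail j.1) w}) fun S => ?_
  have hq0 : 0 ≤ q := by positivity
  by_cases hS : P S
  swap
  · exact (walkProb_eq_zero (A := {w | P S ∧ G.Avoids (G.terminals S) (G.tail j.1) w})
      fun w hw => hS hw.1).trans_le (by positivity)
  refine (walkProb_mono (B := {w | G.Avoids (G.terminals S) (G.tail j.1) w})
    fun w _ hw => hw.2).trans ?_
  rw [hL]
  refine walkProb_avoids_le_pow hq0 (fun x hx => ?_) k s hS.1
  have h1 := mul_walkProb_avoids_le t hx
  have hcard : ((Finset.univ.filter fun d : G.HalfEdge => G.tail d ∉ G.terminals S).card : ℝ) ≤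
      Fintype.card V(G) * Δ :=
    card_filter_tail_le (P := fun x => x ∉ G.terminals S) hΔ fun x hx => not_lt.1 fun hlt => hx (hS.2 x hlt)
  have ht' : (0 : ℝ) < t := by exact_mod_cast ht
  rw [hq, le_div_iff₀ ht', mul_comm]
  refine h1.trans ?_
  refine (mul_le_mul_of_nonneg_right hcard (Nat.cast_nonneg _)).trans (le_of_eq (by ring))

/-- Stationarity bounds the load: per step, each edge is traversed twice on average by walks that
start from the tails of all half-edges. -/
theorem lintegral_load_le (e : E(G)) :
    ∫⁻ ω, (G.load ω e : ENNReal) ∂(G.shortedLaw p L r) ≤ ENNReal.ofReal (2 * r * L) := by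
  classical
  have hload : ∀ ω : G.ShortedOutcome r, (G.load ω e : ENNReal) =
      ∑ j : G.HalfEdge × Fin r,
        {ω : G.ShortedOutcome r | ∃ d ∈ G.shortedWalk ω j, d.1 = e}.indicator 1 ω := by
    intro ω
    rw [load, Finset.card_filter, Nat.cast_sum]
    refine Finset.sum_congr rfl fun j _ => ?_
    simp [Set.indicator_apply]
  simp only [hload]
  rw [lintegral_finsetSum _ fun j _ => (Measurable.of_discrete)]
  have hj : ∀ j : G.HalfEdge × Fin r,
      ∫⁻ ω, {ω : G.ShortedOutcome r | ∃ d ∈ G.shortedWalk ω j, d.1 = e}.indicator 1 ω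
        ∂(G.shortedLaw p L r) ≤
      ENNReal.ofReal (G.walkExp L (G.tail j.1) fun w => (w.countP fun d => d.1 = e : ℕ)) := by
    intro j
    rw [lintegral_indicator_one (.of_discrete)]
    refine (measure_mono (t := {ω | ω.2 j ∈ {w : List G.HalfEdge | ∃ d ∈ w, d.1 = e}})
      fun ω hω => hω.imp fun d hd => ⟨stopAt_subset hd.1, hd.2⟩).trans ?_
    refine shortedLaw_le_of_walkProb_le (Q := fun _ => {w | ∃ d ∈ w, d.1 = e}) fun _ => ?_
    refine walkExp_mono _ _ fun w _ => Set.indicator_apply_le' ?_ fun _ => Nat.cast_nonneg _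
    rintro ⟨d, hd, hde⟩
    have : 0 < w.countP fun d => d.1 = e := List.countP_pos_iff.2 ⟨d, hd, by simpa using hde⟩
    simpa using this
  refine (Finset.sum_le_sum fun j _ => hj j).trans ?_
  rw [← ENNReal.ofReal_sum_of_nonneg fun j _ => walkExp_nonneg _ _ fun w => Nat.cast_nonneg _]
  refine ENNReal.ofReal_le_ofReal (le_of_eq ?_)
  rw [Fintype.sum_prod_type]
  simp only [Finset.sum_const, Finset.card_univ, Fintype.card_fin, nsmul_eq_mul]
  rw [← Finset.mul_sum, sum_walkExp_countP]
  ring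

end Experiment

section Parameters

/-! ### Choice of the parameters -/

variable {G : Graph α β} [Fintype E(G)] {p : E(G) → unitInterval} {L r : ℕ}

/-- The lower bound on `L` is `⌈c * ℓ⌉` blocks of `6 * N ^ 2` steps, where `N = ⌈2 * c * ℓ / b⌉`
half-edges contain a selected edge up to probability `exp (-c * ℓ)`. -/
theorem shortedLaw_misses_le_exp {b c ℓ : ℝ} (hb : 0 < b) (hb1 : b < 1) (hc : 0 < c)
    (hℓ : 1 / 2 ≤ ℓ) (hp : ∀ e, b ≤ (p e : ℝ))
    (hL : 6 * (2 * c + 2) ^ 2 * (c + 2) * (b⁻¹ ^ 2 * ℓ ^ 3) ≤ L) (j : G.HalfEdge × Fin r) :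
    G.shortedLaw p L r {ω | G.Misses ω j} ≤ ENNReal.ofReal (2 * Real.exp (-(c * ℓ))) := by
  have hℓ0 : 0 < ℓ := by linarith
  have hbi : 1 ≤ b⁻¹ := (one_le_inv₀ hb).2 hb1.le
  set N : ℕ := ⌈2 * c * ℓ * b⁻¹⌉₊ with hN
  set k : ℕ := ⌈c * ℓ⌉₊ with hk
  have hNpos : 0 < N := Nat.ceil_pos.2 (by positivity)
  have hN1 : 2 * c * ℓ * b⁻¹ ≤ N := Nat.le_ceil _
  have hN2 : (N : ℝ) ≤ (2 * c + 2) * (b⁻¹ * ℓ) := by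
    have := Nat.ceil_lt_add_one (a := 2 * c * ℓ * b⁻¹) (by positivity)
    nlinarith
  have hk1 : c * ℓ ≤ k := Nat.le_ceil _
  have hk2 : (k : ℝ) ≤ (c + 2) * ℓ := by
    have := Nat.ceil_lt_add_one (a := c * ℓ) (by positivity)
    linarith
  have hNR : (1 : ℝ) ≤ N := by exact_mod_cast hNpos
  have hkL : 6 * N ^ 2 * k ≤ L := by
    have : (6 * (N : ℝ) ^ 2 * k) ≤ L := by
      calc 6 * (N : ℝ) ^ 2 * k ≤ 6 * ((2 * c + 2) * (b⁻¹ * ℓ)) ^ 2 * ((c + 2) * ℓ) := by gcongr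
        _ = 6 * (2 * c + 2) ^ 2 * (c + 2) * (b⁻¹ ^ 2 * ℓ ^ 3) := by ring
        _ ≤ L := hL
    exact_mod_cast this
  have hblock : ∀ (T : Set α) (x : α), G.Reaches T x →
      G.walkProb (6 * N ^ 2) x (G.confined T N x ∅) ≤ Real.exp (-1) := by
    intro T x hx
    have h1 := mul_walkProb_confined_le hNpos (6 * N ^ 2) hx
    push_cast at h1
    have h2 : G.walkProb (6 * N ^ 2) x (G.confined T N x ∅) ≤ 1 / 3 := by
      have h3 : (0 : ℝ) < 6 * N ^ 2 := by positivity
      rw [← mul_le_mul_iff_right₀ h3]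
      nlinarith
    refine h2.trans ?_
    rw [Real.exp_neg, ← one_div]
    exact one_div_le_one_div_of_le (Real.exp_pos _) (Real.exp_one_lt_d9.le.trans (by norm_num))
  have hwalk : ∀ (T : Set α) (x : α), G.Reaches T x →
      G.walkProb L x (G.confined T N x ∅) ≤ Real.exp (-(c * ℓ)) := by
    intro T x hx
    have := walkProb_confined_le_pow (Real.exp_pos _).le (hblock T) k (L - 6 * N ^ 2 * k) hx
    rw [Nat.add_sub_cancel' hkL, ← Real.exp_nat_mul] at this
    exact this.trans (Real.exp_le_exp.2 (by linarith))
  refine (shortedLaw_misses_le hp hb.le N (Real.exp_pos _).le hwalk j).trans ?_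
  rw [← ENNReal.ofReal_add (Real.exp_pos _).le (Real.exp_pos _).le, two_mul]
  refine ENNReal.ofReal_le_ofReal (add_le_add le_rfl (Real.exp_le_exp.2 ?_))
  have : b * (2 * c * ℓ * b⁻¹) ≤ b * N := by gcongr
  have h2 : b * (2 * c * ℓ * b⁻¹) = 2 * (c * ℓ) := by field_simp
  linarith

/-- Two blocks of `L / 2` steps in `shortedLaw_misses_and_deg_le`. The square matters: it leaves a
factor `b` after multiplication with the number of walks, which is of order `b⁻¹`. -/
theorem shortedLaw_misses_and_deg_le_sq [Fintype V(G)] {b c ℓ : ℝ} (hb : 0 < b) (hb1 : b < 1)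
    (hc : 0 < c) (hℓ : 1 / 2 ≤ ℓ)
    (hL : 32 * (c + 2) * (b⁻¹ ^ 2 * ℓ ^ 3) ≤ L) (j : G.HalfEdge × Fin r) :
    G.shortedLaw p L r
      {ω | G.Misses ω j ∧ ∀ x, 2 * (c + 2) * ℓ * b⁻¹ < G.deg x → x ∈ G.terminals ω.1} ≤
      ENNReal.ofReal (((Fintype.card V(G) : ℝ) ^ 2 * b) ^ 2) := by
  have hℓ0 : 0 < ℓ := by linarith
  have hbi : 1 ≤ b⁻¹ := (one_le_inv₀ hb).2 hb1.le
  have hℓ2 : 1 / 4 ≤ ℓ ^ 2 := by nlinarith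
  have hL1 : 8 * (c + 2) * (b⁻¹ ^ 2 * ℓ) ≤ L := by
    refine le_trans ?_ hL
    have : 0 ≤ 32 * (c + 2) * (b⁻¹ ^ 2 * ℓ) := by positivity
    nlinarith
  have hL2 : (2 : ℝ) ≤ L := by
    refine le_trans ?_ hL1
    have : 1 * (1 / 2) ≤ b⁻¹ ^ 2 * ℓ := by
      gcongr
      exact one_le_pow₀ hbi
    nlinarith
  have hL2' : 2 ≤ L := by exact_mod_cast hL2
  have ht : (L : ℝ) ≤ 4 * (L / 2 : ℕ) := by exact_mod_cast (by omega : L ≤ 4 * (L / 2))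
  have ht0 : 0 < L / 2 := by omega
  refine (shortedLaw_misses_and_deg_le (by positivity) ht0 2 (L % 2) (by omega) j).trans ?_
  refine ENNReal.ofReal_le_ofReal (pow_le_pow_left₀ (by positivity) ?_ 2)
  have ht0' : (0 : ℝ) < (L / 2 : ℕ) := by exact_mod_cast ht0
  rw [mul_div_assoc]
  gcongr
  rw [div_le_iff₀ ht0']
  have h1 : 2 * (c + 2) * (b⁻¹ ^ 2 * ℓ) ≤ (L / 2 : ℕ) := by linarith
  calc 2 * (c + 2) * ℓ * b⁻¹ = b * (2 * (c + 2) * (b⁻¹ ^ 2 * ℓ)) := by field_simp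
    _ ≤ b * (L / 2 : ℕ) := by gcongr

/-- With at least this exponent `c'`, a bound of `n ^ (1 - c')` on the probability that a given walk
misses survives the union bound in `shortedLaw_exists_misses_le_rpow`: it pays for the target
exponent `c`, for the number of walks when `ε⁻¹ ≤ n ^ a`, for a power of `n` that dominates `β⁻¹`,
and, in the last summand, for the constant factors. -/
def missExponent (c a Cρ : ℝ) : ℝ := 2 * c + 4 * a + 14 + 16 * (c + 2) * Cρ

theorem shortedLaw_exists_misses_le_rpow [Fintype V(G)] {c a Cρ b ε : ℝ} (hc : 0 < c)
    (hCρ : 0 < Cρ) (hb : 0 < b) (hb1 : b < 1) (hp : ∀ e, b ≤ (p e : ℝ))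
    (hn : 2 ≤ Fintype.card V(G)) (hε : (Fintype.card V(G) : ℝ) ^ (-a) ≤ ε)
    (hr : (r : ℝ) ≤ Cρ * (Real.log (Fintype.card V(G)) * ε⁻¹ ^ 2))
    (hL : 32 * (c + 2) * (b⁻¹ ^ 2 * Real.log (Fintype.card V(G)) ^ 3) ≤ L)
    (hmiss : ∀ j : G.HalfEdge × Fin r, G.shortedLaw p L r {ω | G.Misses ω j} ≤
      ENNReal.ofReal ((Fintype.card V(G) : ℝ) ^ (1 - missExponent c a Cρ))) :
    G.shortedLaw p L r {ω | ∃ j, G.Misses ω j} ≤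
      ENNReal.ofReal ((Fintype.card V(G) : ℝ) ^ (-c)) := by
  set n : ℝ := (Fintype.card V(G) : ℝ) with hn_def
  have hn2 : (2 : ℝ) ≤ n := by
    rw [hn_def]
    exact_mod_cast hn
  have hn0 : 0 < n := by linarith
  have hn1 : 1 ≤ n := by linarith
  set ℓ := Real.log n with hℓ_def
  have hℓ : 1 / 2 ≤ ℓ := by
    have := Real.log_le_log (by norm_num) hn2
    linarith [Real.log_two_gt_d9]
  have hℓn : ℓ ≤ n := by linarith [Real.log_le_sub_one_of_pos hn0]
  set Δ := 2 * (c + 2) * ℓ * b⁻¹ with hΔ_def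
  have hΔ : 0 ≤ Δ := by positivity
  set B := 8 * (c + 2) * Cρ + 1 with hB_def
  have hB1 : 1 ≤ B := by
    have : 0 < 8 * (c + 2) * Cρ := by positivity
    linarith
  have hB : 8 * (c + 2) * Cρ ≤ n ^ B := by
    have h1 := one_add_mul_self_le_rpow_one_add (s := 1) (by norm_num) hB1
    rw [one_add_one_eq_two] at h1
    have h2 := Real.rpow_le_rpow (by norm_num) hn2 (by linarith : 0 ≤ B)
    linarith
  -- the number of walks in the union bound
  have hwalks : r * (n * Δ) ≤ n ^ (3 + 2 * a + B) / 4 * b⁻¹ := by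
    have hε' : ε⁻¹ ≤ n ^ a := by
      rw [← inv_inv (n ^ a), ← Real.rpow_neg hn0.le]
      exact inv_anti₀ (Real.rpow_pos_of_pos hn0 _) hε
    have hε0 : 0 < ε := (Real.rpow_pos_of_pos hn0 _).trans_le hε
    have hr' : (r : ℝ) ≤ Cρ * (n * (n ^ a) ^ 2) := hr.trans (by gcongr)
    calc r * (n * Δ) ≤ Cρ * (n * (n ^ a) ^ 2) * (n * (2 * (c + 2) * n * b⁻¹)) := by
          rw [hΔ_def]; gcongr
      _ = 8 * (c + 2) * Cρ * (n ^ 3 * n ^ (2 * a)) / 4 * b⁻¹ := by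
          rw [mul_comm 2 a, Real.rpow_mul hn0.le, Real.rpow_two]; ring
      _ ≤ n ^ B * (n ^ 3 * n ^ (2 * a)) / 4 * b⁻¹ := by gcongr
      _ = n ^ (3 + 2 * a + B) / 4 * b⁻¹ := by
          rw [Real.rpow_add hn0 (3 + 2 * a) B, Real.rpow_add hn0 3 (2 * a),
            ← Real.rpow_natCast n 3]
          push_cast
          ring
  have hfirst : n * Real.exp (-(b * Δ / 2)) ≤ n ^ (-c) / 2 := by
    have h1 : -(b * Δ / 2) = ℓ * (-c - 2) := by rw [hΔ_def]; field_simp; ring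
    rw [h1, hℓ_def, ← Real.rpow_def_of_pos hn0, ← Real.rpow_one_add' hn0.le (by linarith)]
    have h2 : (1 + (-c - 2) : ℝ) = -c - 1 := by ring
    rw [h2, Real.rpow_sub_one hn0.ne']
    have := Real.rpow_pos_of_pos hn0 (-c)
    gcongr
  have hreduce : ∀ x, x ≤ -c → n ^ x / 4 ≤ n ^ (-c) / 2 := by
    intro x hx
    have h1 := Real.rpow_le_rpow_of_exponent_le hn1 hx
    have h2 := Real.rpow_pos_of_pos hn0 (-c)
    linarith
  suffices ∃ q, 0 ≤ q ∧ n ^ (3 + 2 * a + B) / 4 * b⁻¹ * q ≤ n ^ (-c) / 2 ∧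
      ∀ j : G.HalfEdge × Fin r, G.shortedLaw p L r
        {ω | G.Misses ω j ∧ ∀ x, Δ < G.deg x → x ∈ G.terminals ω.1} ≤ ENNReal.ofReal q by
    obtain ⟨q, hq, hq1, hq2⟩ := this
    refine (shortedLaw_exists_misses_le hp hb.le hΔ hq hq2).trans (ENNReal.ofReal_le_ofReal ?_)
    have := mul_le_mul_of_nonneg_right hwalks hq
    linarith
  -- the factor `b⁻¹` of the number of walks is polynomial in `n`, or else `b` is so small that
  -- the hitting time of the terminals is much smaller than `L`
  by_cases hcase : b⁻¹ ≤ n ^ (c + 2 * a + 8 + B)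
  · refine ⟨_, Real.rpow_nonneg hn0.le _, ?_, fun j =>
      (measure_mono fun ω hω => hω.1).trans (hmiss j)⟩
    refine le_trans ?_ (hreduce (3 + 2 * a + B + (c + 2 * a + 8 + B) +
      (1 - missExponent c a Cρ)) (by rw [missExponent, hB_def]; linarith))
    rw [Real.rpow_add hn0 (3 + 2 * a + B + (c + 2 * a + 8 + B)),
      Real.rpow_add hn0 (3 + 2 * a + B) (c + 2 * a + 8 + B), ← mul_div_right_comm,
      ← mul_div_right_comm]
    gcongr
  · refine ⟨(n ^ 2 * b) ^ 2, by positivity, ?_, fun j =>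
      shortedLaw_misses_and_deg_le_sq hb hb1 hc hℓ hL j⟩
    have hb' : b ≤ n ^ (-(c + 2 * a + 8 + B)) := by
      rw [Real.rpow_neg hn0.le]
      exact (le_inv_comm₀ hb (Real.rpow_pos_of_pos hn0 _)).2 (not_le.1 hcase).le
    refine le_trans ?_ (hreduce (3 + 2 * a + B + 4 + -(c + 2 * a + 8 + B)) (by linarith))
    have h1 : n ^ (3 + 2 * a + B) / 4 * b⁻¹ * (n ^ 2 * b) ^ 2 =
        n ^ (3 + 2 * a + B) * n ^ (4 : ℝ) * b / 4 := by
      rw [show (4 : ℝ) = ((4 : ℕ) : ℝ) by norm_num, Real.rpow_natCast]; field_simp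
    rw [h1, Real.rpow_add hn0 (3 + 2 * a + B + 4), Real.rpow_add hn0 (3 + 2 * a + B) 4]
    gcongr

end Parameters

end Graph
end

theorem mainTheorem5 (c₀ c a Cρ : ℝ) (hc₀ : 0 < c₀) (hc : 0 < c) (ha : 0 < a) (hCρ : 0 < Cρ) :
    ∃ K₀ : ℝ, 0 < K₀ ∧ ∀ K₁ : ℝ, ∃ C : ℝ, 0 < C ∧
      ∀ (V E : Type*) (G : Graph V E) [Fintype V(G)] [Fintype E(G)]
        (β ε : ℝ) (p : E(G) → unitInterval) (L ρ : ℕ),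
        0 < β → β < 1 → 0 < ε → ε < 1 →
        (∀ e, β ≤ (p e : ℝ)) →
        c₀ * Real.log (Fintype.card V(G)) ≤ β * (Fintype.card E(G) : ℝ) →
        K₀ * (β⁻¹ ^ 2 * Real.log (Fintype.card V(G)) ^ 3) ≤ (L : ℝ) →
        (L : ℝ) ≤ K₁ * (β⁻¹ ^ 2 * Real.log (Fintype.card V(G)) ^ 3) →
        (ρ : ℝ) ≤ Cρ * (Real.log (Fintype.card V(G)) * ε⁻¹ ^ 2) →
        (∀ j : G.HalfEdge × Fin ρ,
          G.shortedLaw p L ρ {ω | G.Misses ω j}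
            ≤ ENNReal.ofReal ((Fintype.card V(G) : ℝ) ^ (-c))) ∧
        ((Fintype.card V(G) : ℝ) ^ (-a) ≤ ε →
          G.shortedLaw p L ρ {ω | ∃ j, G.Misses ω j}
            ≤ ENNReal.ofReal ((Fintype.card V(G) : ℝ) ^ (-c))) ∧
        (∀ e : E(G),
          ∫⁻ ω, (G.load ω e : ENNReal) ∂(G.shortedLaw p L ρ)
            ≤ ENNReal.ofReal
                (C * (β⁻¹ ^ 2 * Real.log (Fintype.card V(G)) ^ 4 * ε⁻¹ ^ 2))) ∧
        (∀ (t : ℕ) (v : V(G)),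
          ∑ u : V(G), (G.deg u : ENNReal) *
              (G.walkLaw t u).toMeasure {w | G.endVertex u w = v}
            = (G.deg v : ENNReal)) := by
  set c' := Graph.missExponent c a Cρ with hc'_def
  have hc' : c + 1 ≤ c' := by
    have : 0 < 16 * (c + 2) * Cρ := by positivity
    rw [hc'_def, Graph.missExponent]
    linarith
  have hc'0 : 0 < c' := by linarith
  refine ⟨6 * (2 * c' + 2) ^ 2 * (c' + 2) + 32 * (c + 2), by positivity, fun K₁ =>
    ⟨2 * Cρ * |K₁| + 1, by positivity, ?_⟩⟩
  intro V E G _ _ β ε p L ρ hβ hβ1 hε hε1 hp _ hL hL' hρ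
  have hℓ0 : 0 ≤ Real.log (Fintype.card V(G)) := Real.log_natCast_nonneg _
  have hX : 0 ≤ β⁻¹ ^ 2 * Real.log (Fintype.card V(G)) ^ 3 := by positivity
  have hmiss : 2 ≤ Fintype.card V(G) → ∀ j : G.HalfEdge × Fin ρ,
      G.shortedLaw p L ρ {ω | G.Misses ω j}
        ≤ ENNReal.ofReal ((Fintype.card V(G) : ℝ) ^ (1 - c')) := by
    intro hn j
    have hn2 : (2 : ℝ) ≤ Fintype.card V(G) := by exact_mod_cast hn
    have hn0 : (0 : ℝ) < Fintype.card V(G) := by linarith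
    have hℓ : 1 / 2 ≤ Real.log (Fintype.card V(G)) := by
      have := Real.log_le_log (by norm_num) hn2
      linarith [Real.log_two_gt_d9]
    have hL1 : 6 * (2 * c' + 2) ^ 2 * (c' + 2) *
        (β⁻¹ ^ 2 * Real.log (Fintype.card V(G)) ^ 3) ≤ L :=
      le_trans (mul_le_mul_of_nonneg_right (by linarith) hX) hL
    refine (Graph.shortedLaw_misses_le_exp hβ hβ1 hc'0 hℓ hp hL1 j).trans
      (ENNReal.ofReal_le_ofReal ?_)
    rw [sub_eq_add_neg, Real.rpow_add hn0, Real.rpow_one, Real.rpow_def_of_pos hn0 (-c'),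
      mul_comm c', mul_neg]
    gcongr
  -- with at most one vertex there are no walks
  have hsmall : ¬ 2 ≤ Fintype.card V(G) → ρ = 0 := by
    intro hn
    have h1 : Real.log (Fintype.card V(G)) = 0 := by
      have : Fintype.card V(G) = 0 ∨ Fintype.card V(G) = 1 := by omega
      rcases this with h | h <;> simp [h]
    rw [h1, zero_mul, mul_zero] at hρ
    exact_mod_cast le_antisymm hρ (Nat.cast_nonneg _)
  refine ⟨fun j => ?_, fun hεn => ?_, fun e => ?_, fun t v => ?_⟩
  · by_cases hn : 2 ≤ Fintype.card V(G)
    · refine (hmiss hn j).trans (ENNReal.ofReal_le_ofReal ?_)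
      exact Real.rpow_le_rpow_of_exponent_le (by exact_mod_cast (by omega : 1 ≤ _)) (by linarith)
    · obtain rfl := hsmall hn
      exact j.2.elim0
  · by_cases hn : 2 ≤ Fintype.card V(G)
    · refine Graph.shortedLaw_exists_misses_le_rpow hc hCρ hβ hβ1 hp hn hεn hρ ?_ (hmiss hn)
      exact le_trans (mul_le_mul_of_nonneg_right (le_add_of_nonneg_left (by positivity)) hX) hL
    · obtain rfl := hsmall hn
      refine (MeasureTheory.measure_mono (t := ∅) ?_).trans (by simp)
      rintro ω ⟨j, _⟩
      exact j.2.elim0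
  · refine (Graph.lintegral_load_le e).trans (ENNReal.ofReal_le_ofReal ?_)
    have hL'' : (L : ℝ) ≤ |K₁| * (β⁻¹ ^ 2 * Real.log (Fintype.card V(G)) ^ 3) :=
      hL'.trans (mul_le_mul_of_nonneg_right (le_abs_self _) hX)
    have hY : 0 ≤ β⁻¹ ^ 2 * Real.log (Fintype.card V(G)) ^ 4 * ε⁻¹ ^ 2 := by positivity
    calc 2 * (ρ : ℝ) * L
        ≤ 2 * (Cρ * (Real.log (Fintype.card V(G)) * ε⁻¹ ^ 2)) *
          (|K₁| * (β⁻¹ ^ 2 * Real.log (Fintype.card V(G)) ^ 3)) := by gcongr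
      _ = 2 * Cρ * |K₁| * (β⁻¹ ^ 2 * Real.log (Fintype.card V(G)) ^ 4 * ε⁻¹ ^ 2) := by ring
      _ ≤ _ := mul_le_mul_of_nonneg_right (by linarith) hY
  · exact Graph.sum_deg_mul_walkLaw_endVertex (G := G) t v
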